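/- Conventions. Only the (braided) monoidal structure of tensor categories enters below, so "(braided) tensor category" may be read as "(braided) monoidal category", in particular any (braided) $k$-linear abelian tensor category; a tensor functor is a strong monoidal functor, and an equivalence of abelian categories enters only as an equivalence of categories. For a monoidal category $\mathcal{B}$, the Drinfeld center $\mathcal{Z}(\mathcal{B})$ has as objects pairs $(Z,\beta)$ with a half-braiding $\beta_M\colon Z\otimes M\xrightarrow{\sim} M\otimes Z$, and braiding $(Z,\beta)\otimes(Z',\beta')\to(Z',\beta')\otimes(Z,\beta)$ given by $\beta_{Z'}$. For a braided category $(\mathcal{C},c)$, $\overline{\mathcal{C}}$ is $\mathcal{C}$ with the reversed braiding $V\otimes W\to W\otimes V$ given by $c_{W,V}^{-1}$. For an algebra $N$ in $\mathcal{C}$, $\mathrm{Rep}(N)(\mathcal{C})$ is the category of left $N$-modules in $\mathcal{C}$ and $\mathfrak{f}\colon \mathrm{Rep}(N)(\mathcal{C})\to\mathcal{C}$ is the forgetful functor. Let $\mathcal{C}$ be a braided tensor category and $\mathcal{B}$ a tensor category, with a tensor functor $\iota\colon\mathcal{C}\to\mathcal{B}$ that extends to a braided tensor functor $(\iota,c')\colon\overline{\mathcal{C}}\to\mathcal{Z}(\mathcal{B})$,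 where $c'_{V,M}\colon\iota(V)\otimes M\to M\otimes\iota(V)$. Let $\mathfrak{l}\colon\mathcal{B}\to\mathcal{C}$ be a tensor functor with tensor structure $\mathfrak{l}^T_{X,Y}\colon\mathfrak{l}(X\otimes Y)\xrightarrow{\sim}\mathfrak{l}(X)\otimes\mathfrak{l}(Y)$, together with a monoidal natural isomorphism $\xi\colon\mathfrak{l}\circ\iota\cong\mathrm{id}_{\mathcal{C}}$, such that $\mathfrak{l}(c')=c^{-1}$: under $\mathfrak{l}^T$ and $\xi$, the morphism $\mathfrak{l}(c'_{V,M})$ becomes $c_{\mathfrak{l}(M),V}^{-1}\colon V\otimes\mathfrak{l}(M)\to\mathfrak{l}(M)\otimes V$ for all $V\in\mathcal{C}$, $M\in\mathcal{B}$. Let $N$ be an algebra in $\mathcal{C}$, let $F\colon\mathrm{Rep}(N)(\mathcal{C})\to\mathcal{B}$ be an equivalence of (abelian) categories, and let $\eta\colon\mathfrak{l}\circ F\cong\mathfrak{f}$ be a natural isomorphism. Regard $\mathcal{B}$ as a right $\mathcal{C}$-module category by $M.V=M\otimes\iota(V)$, and $\mathrm{Rep}(N)(\mathcal{C})$ as a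 right $\mathcal{C}$-module category by $M.V=\mathfrak{f}(M)\otimes V$ with $N$ acting on the first factor only. Suppose that $F$ carries the structure $F^T_{M,V}\colon F(M.V)\xrightarrow{\sim}F(M)\otimes\iota(V)$ of an equivalence of right $\mathcal{C}$-module categories, and that this structure becomes trivial under $\mathfrak{l}$: for all $M\in\mathrm{Rep}(N)(\mathcal{C})$ and $V\in\mathcal{C}$, $$(\eta_M\otimes\mathrm{id}_V)\circ(\mathrm{id}\otimes\xi_V)\circ\mathfrak{l}^T_{F(M),\iota(V)}\circ\mathfrak{l}(F^T_{M,V})=\eta_{M.V}\colon\ \mathfrak{l}(F(M.V))\to\mathfrak{f}(M)\otimes V .$$ Then there is a coalgebra structure $(\Delta,\epsilon)$ on $N$ making the algebra $N$ a bialgebra in the braided category $\mathcal{C}$, such that $F$ admits the structure of an equivalence of tensor categories; here $X\otimes Y$ in $\mathrm{Rep}(N)(\mathcal{C})$ is the tensor product in $\mathcal{C}$ with the action $N\otimes X\otimes Y\xrightarrow{\Delta}N\otimes N\otimes X\otimes Y\xrightarrow{\mathrm{id}\otimes c_{N,X}\otimes\mathrm{id}}N\otimes X\otimes N\otimes Y\to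 X\otimes Y$, and the unit object is $1_{\mathcal{C}}$ with the action given by $\epsilon$. If moreover $\mathcal{B}$ and $\mathcal{C}$ are rigid, then this bialgebra $N$ is a Hopf algebra with invertible antipode and $\mathrm{Rep}(N)(\mathcal{C})$ is rigid, so that $F$ is an equivalence of rigid tensor categories. -/

import Mathlib

open CategoryTheory MonoidalCategory

universe v₁ v₂ u₁ u₂

namespace SplittingHopf

section Modules

open scoped MonObj

variable {C : Type u₁} [Category.{v₁} C] [MonoidalCategory C] {N : C} [MonObj N]

/-- The action map `N ⊗ M ⟶ M` of a module `M` over the algebra `N`. -/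
abbrev act (M : Mod C N) : N ⊗ M.X ⟶ M.X := ModObj.smul (M := N) (X := M.X)

theorem act_one (M : Mod C N) : η[N] ▷ M.X ≫ act M = (λ_ M.X).hom :=
  ModObj.one_smul_self N M.X

theorem act_mul (M : Mod C N) : μ[N] ▷ M.X ≫ act M = (α_ N N M.X).hom ≫ N ◁ act M ≫ act M :=
  ModObj.mul_smul_self N M.X

theorem act_hom {M M' : Mod C N} (f : M ⟶ M') : act M ≫ f.hom = N ◁ f.hom ≫ act M' :=
  IsModHom.smul_hom (A := N) (f := f.hom)

/-- The module with underlying object `X` and action `a`. -/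
abbrev modMk (X : C) (a : N ⊗ X ⟶ X) (h₁ : η[N] ▷ X ≫ a = (λ_ X).hom)
    (h₂ : μ[N] ▷ X ≫ a = (α_ N N X).hom ≫ N ◁ a ≫ a) : Mod C N where
  X := X
  mod :=
    { smul := a
      one_smul := h₁
      mul_smul := h₂ }

/-- An `N`-linear morphism of `C`, as a morphism of modules. -/
abbrev homMk {M M' : Mod C N} (f : M.X ⟶ M'.X) (h : act M ≫ f = N ◁ f ≫ act M') : M ⟶ M' :=
  Mod.Hom.mk' f h

/-- An `N`-linear isomorphism of `C`, as an isomorphism of modules. -/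
abbrev isoMk {M M' : Mod C N} (e : M.X ≅ M'.X) (h : act M ≫ e.hom = N ◁ e.hom ≫ act M') :
    M ≅ M' where
  hom := homMk e.hom h
  inv := homMk e.inv (by
    rw [Iso.comp_inv_eq, Category.assoc, h, ← whiskerLeft_comp_assoc]
    simp)
  hom_inv_id := by ext; simp
  inv_hom_id := by ext; simp

end Modules

section ModuleCategories

variable {C : Type u₁} [Category.{v₁} C] [MonoidalCategory C]

/-- For an `N`-module `M` and an object `V`, the module `M.V`: the object `M ⊗ V`
with `N` acting on the first factor only. -/
abbrev actObj {N : C} [MonObj N] (M : Mod C N) (V : C) : Mod C N :=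
  modMk (M.X ⊗ V) ((α_ N M.X V).inv ≫ act M ▷ V)
    (by
      rw [associator_inv_naturality_left_assoc, ← comp_whiskerRight,
        act_one]
      simp)
    (by
      rw [associator_inv_naturality_left_assoc, ← comp_whiskerRight,
        act_mul]
      simp)

theorem act_actObj {N : C} [MonObj N] (M : Mod C N) (V : C) :
    act (actObj M V) = (α_ N M.X V).inv ≫ act M ▷ V := rfl

/-- The right `C`-module category structure `(M, V) ↦ M.V` on the category of `N`-modules. -/
abbrev repRightAction (N : C) [MonObj N] : MonoidalRightAction C (Mod C N) where
  actionObj M V := actObj M V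
  actionHomLeft {M M'} f V := homMk (M := actObj M V) (M' := actObj M' V) (f.hom ▷ V) (by
    rw [act_actObj, act_actObj, Category.assoc, ← comp_whiskerRight, act_hom]
    simp)
  actionHomRight M {V W} g := homMk (M := actObj M V) (M' := actObj M W) (M.X ◁ g) (by
    rw [act_actObj, act_actObj, Category.assoc, ← whisker_exchange]
    simp)
  actionAssocIso M V W :=
    isoMk (M := actObj M (V ⊗ W)) (M' := actObj (actObj M V) W) (α_ M.X V W).symm (by
      simp only [act_actObj]
      simp)
  actionUnitIso M := isoMk (M := actObj M (𝟙_ C)) (M' := M) (ρ_ M.X) (by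
    simp only [act_actObj]
    simp)
  actionHom_def _ _ := rfl
  actionHomRight_id _ _ := by ext; simp
  id_actionHomLeft _ _ := by ext; simp
  actionHom_comp _ _ _ _ := by ext; simp [whisker_exchange_assoc]
  actionAssocIso_hom_naturality f g h := by ext; simp [MonoidalCategory.tensorHom_def]
  actionUnitIso_hom_naturality _ := by ext; simp
  actionHomRight_whiskerRight _ _ _ := by ext; simp
  whiskerRight_actionHomLeft _ _ _ _ _ := by ext; simp
  actionHom_associator _ _ _ _ := by ext; simp
  actionHom_leftUnitor _ _ := by ext; simp
  actionHom_rightUnitor _ _ := by ext; simp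

end ModuleCategories

section Along

variable {C : Type u₁} [Category.{v₁} C] [MonoidalCategory C]
  {B : Type u₂} [Category.{v₂} B] [MonoidalCategory B]

open Functor.LaxMonoidal Functor.OplaxMonoidal in
/-- The right `C`-module category structure `(M, V) ↦ M ⊗ ι(V)` on `B` along a tensor functor
`ι : C ⥤ B`. -/
abbrev rightActionAlong (ι : C ⥤ B) [ι.Monoidal] : MonoidalRightAction C B where
  actionObj M V := M ⊗ ι.obj V
  actionHomLeft f V := f ▷ ι.obj V
  actionHomRight M _ _ g := M ◁ ι.map g
  actionAssocIso M V W :=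
    whiskerLeftIso M (Functor.Monoidal.μIso ι V W).symm ≪≫ (α_ M (ι.obj V) (ι.obj W)).symm
  actionUnitIso M := whiskerLeftIso M (Functor.Monoidal.εIso ι).symm ≪≫ ρ_ M
  actionHom_def _ _ := rfl
  actionHomRight_id _ _ := by simp
  id_actionHomLeft _ _ := by simp
  actionHom_comp _ _ _ _ := by simp [whisker_exchange_assoc]
  actionAssocIso_hom_naturality {d₁ d₂ c₁ c₂ c₃ c₄} f g h := by
    have e : ι.map (g ⊗ₘ h) ≫ δ ι c₂ c₄ = δ ι c₁ c₃ ≫ (ι.map g ⊗ₘ ι.map h) :=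
      (δ_natural ι g h).symm
    simp only [Iso.trans_hom, whiskerLeftIso_hom, Iso.symm_hom, Functor.Monoidal.μIso_inv,
      Category.assoc]
    rw [← whiskerLeft_comp_assoc, e, MonoidalCategory.tensorHom_def, whiskerLeft_comp_assoc,
      ← whisker_exchange_assoc]
    simp
  actionUnitIso_hom_naturality _ := by simp [← whisker_exchange_assoc]
  actionHomRight_whiskerRight {c' c''} f c d := by
    have e : ι.map (f ▷ c) = δ ι c' c ≫ ι.map f ▷ ι.obj c ≫ μ ι c'' c := by simp
    simp only [e, MonoidalCategory.whiskerLeft_comp]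
    simp
  whiskerRight_actionHomLeft c c' c'' f d := by
    have e : ι.map (c ◁ f) = δ ι c c' ≫ ι.obj c ◁ ι.map f ≫ μ ι c c'' := by simp
    simp only [e, MonoidalCategory.whiskerLeft_comp]
    simp
  actionHom_associator c₁ c₂ c₃ d := by
    have e : δ ι (c₁ ⊗ c₂) c₃ ≫ δ ι c₁ c₂ ▷ ι.obj c₃ =
        ι.map (α_ c₁ c₂ c₃).hom ≫ δ ι c₁ (c₂ ⊗ c₃) ≫ ι.obj c₁ ◁ δ ι c₂ c₃ ≫
          (α_ (ι.obj c₁) (ι.obj c₂) (ι.obj c₃)).inv := by simp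
    have e' := congrArg (fun t => d ◁ t) e
    simp only [MonoidalCategory.whiskerLeft_comp] at e'
    simp [reassoc_of% e']
  actionHom_leftUnitor c d := by
    have e : ι.map (λ_ c).hom = δ ι (𝟙_ C) c ≫ η ι ▷ ι.obj c ≫ (λ_ (ι.obj c)).hom := by simp
    simp only [e, MonoidalCategory.whiskerLeft_comp]
    simp [-Functor.LaxMonoidal.left_unitality]
  actionHom_rightUnitor c d := by
    have e : ι.map (ρ_ c).hom = δ ι c (𝟙_ C) ≫ ι.obj c ◁ η ι ≫ (ρ_ (ι.obj c)).hom := by simp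
    simp only [e, MonoidalCategory.whiskerLeft_comp]
    simp [-Functor.LaxMonoidal.right_unitality]

end Along

section Bialgebras

open scoped MonObj ComonObj

variable {C : Type u₁} [Category.{v₁} C] [MonoidalCategory C] [BraidedCategory C]

/-- The compatibility making an object with an algebra structure and a coalgebra structure a
bialgebra in the braided category `C`; `tensorμ N N N N` is `id ⊗ c_{N,N} ⊗ id`. -/
class IsBialgebra (N : C) [MonObj N] [ComonObj N] : Prop where
  mul_comul : μ[N] ≫ Δ[N] = (Δ[N] ⊗ₘ Δ[N]) ≫ tensorμ N N N N ≫ (μ[N] ⊗ₘ μ[N])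
  one_comul : η[N] ≫ Δ[N] = (λ_ (𝟙_ C)).inv ≫ (η[N] ⊗ₘ η[N])
  mul_counit : μ[N] ≫ ε[N] = (ε[N] ⊗ₘ ε[N]) ≫ (λ_ (𝟙_ C)).hom
  one_counit : η[N] ≫ ε[N] = 𝟙 (𝟙_ C)

/-- A bialgebra is a Hopf algebra if it has an antipode; antipodes are required to be
invertible. -/
class IsHopfAlgebra (N : C) [MonObj N] [ComonObj N] : Prop extends IsBialgebra N where
  exists_antipode : ∃ S : N ⟶ N, IsIso S ∧
    Δ[N] ≫ S ▷ N ≫ μ[N] = ε[N] ≫ η[N] ∧ Δ[N] ≫ N ◁ S ≫ μ[N] = ε[N] ≫ η[N]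

variable {N : C} [MonObj N] [ComonObj N]

/-- The action of a bialgebra `N` on the tensor product `X ⊗ Y` of two modules: comultiply, move
the second copy of `N` past `X` with the braiding `c_{N,X}`, and act on both factors. -/
abbrev tensorAct (X Y : Mod C N) : N ⊗ (X.X ⊗ Y.X) ⟶ X.X ⊗ Y.X :=
  Δ[N] ▷ (X.X ⊗ Y.X) ≫ tensorμ N N X.X Y.X ≫ (act X ⊗ₘ act Y)

/-- The tensor product of linear morphisms is linear. -/
theorem tensorAct_hom {X X' Y Y' : Mod C N} (f : X ⟶ X') (g : Y ⟶ Y') :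
    tensorAct X Y ≫ (f.hom ⊗ₘ g.hom) = N ◁ (f.hom ⊗ₘ g.hom) ≫ tensorAct X' Y' := by
  simp only [tensorAct, Category.assoc]
  rw [tensorHom_comp_tensorHom, act_hom, act_hom, ← tensorHom_comp_tensorHom,
    ← tensorμ_natural_right_assoc, whisker_exchange_assoc]

variable [IsBialgebra N]

/-- The tensor product of two modules over a bialgebra. -/
abbrev tensorMod (X Y : Mod C N) : Mod C N :=
  modMk (X.X ⊗ Y.X) (tensorAct X Y)
    (by
      rw [tensorAct, ← comp_whiskerRight_assoc, IsBialgebra.one_comul, comp_whiskerRight_assoc,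
        tensorμ_natural_left_assoc, tensorHom_comp_tensorHom, act_one, act_one,
        ← tensor_left_unitality])
    (by
      simp only [tensorAct]
      rw [← comp_whiskerRight_assoc, IsBialgebra.mul_comul, comp_whiskerRight_assoc,
        comp_whiskerRight_assoc, tensorμ_natural_left_assoc, tensorHom_comp_tensorHom, act_mul,
        act_mul, ← tensorHom_comp_tensorHom, tensor_associativity_assoc,
        ← tensorHom_comp_tensorHom, ← tensorμ_natural_right_assoc,
        MonoidalCategory.tensorHom_def Δ[N] Δ[N]]
      simp only [MonoidalCategory.whiskerLeft_comp, Category.assoc, whisker_exchange_assoc,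
        comp_whiskerRight, whisker_assoc, associator_naturality_left_assoc, Iso.inv_hom_id_assoc])

/-- The trivial module: the unit object with `N` acting through the counit. -/
abbrev unitMod (N : C) [MonObj N] [ComonObj N] [IsBialgebra N] : Mod C N :=
  modMk (𝟙_ C) ((ρ_ N).hom ≫ ε[N])
    (by
      rw [rightUnitor_naturality_assoc, IsBialgebra.one_counit]
      monoidal)
    (by
      rw [rightUnitor_naturality_assoc, IsBialgebra.mul_counit, MonoidalCategory.tensorHom_def']
      simp [unitors_equal])

theorem act_tensorMod (X Y : Mod C N) : act (tensorMod X Y) = tensorAct X Y := rfl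

theorem act_unitMod : act (unitMod N) = (ρ_ N).hom ≫ ε[N] := rfl

theorem tensorAct_assoc (X Y Z : Mod C N) :
    tensorAct (tensorMod X Y) Z ≫ (α_ X.X Y.X Z.X).hom =
      N ◁ (α_ X.X Y.X Z.X).hom ≫ tensorAct X (tensorMod Y Z) := by
  simp only [tensorAct, act_tensorMod, Category.assoc]
  have e₁ : ((Δ[N] ▷ (X.X ⊗ Y.X) ≫ tensorμ N N X.X Y.X ≫ (act X ⊗ₘ act Y)) ⊗ₘ act Z) =
      (Δ[N] ▷ (X.X ⊗ Y.X) ⊗ₘ 𝟙 N ▷ Z.X) ≫ tensorμ N N X.X Y.X ▷ (N ⊗ Z.X) ≫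
        ((act X ⊗ₘ act Y) ⊗ₘ act Z) := by
    simp [MonoidalCategory.tensorHom_def]
  have e₂ : (act X ⊗ₘ (Δ[N] ▷ (Y.X ⊗ Z.X) ≫ tensorμ N N Y.X Z.X ≫ (act Y ⊗ₘ act Z))) =
      (𝟙 N ▷ X.X ⊗ₘ Δ[N] ▷ (Y.X ⊗ Z.X)) ≫ (N ⊗ X.X) ◁ tensorμ N N Y.X Z.X ≫
        (act X ⊗ₘ (act Y ⊗ₘ act Z)) := by
    simp [MonoidalCategory.tensorHom_def']
  rw [e₁, e₂]
  simp only [Category.assoc]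
  rw [associator_naturality, ← tensorμ_natural_left_assoc, ← tensorμ_natural_left_assoc,
    associator_monoidal_assoc, tensorHom_id, id_tensorHom, whisker_exchange_assoc,
    whisker_exchange_assoc, ← comp_whiskerRight_assoc, ← comp_whiskerRight_assoc,
    ComonObj.comul_assoc, MonoidalCategory.tensorHom_def]
  simp only [comp_whiskerRight, Category.assoc]

theorem tensorAct_leftUnitor (X : Mod C N) :
    tensorAct (unitMod N) X ≫ (λ_ X.X).hom = N ◁ (λ_ X.X).hom ≫ act X := by
  have e₁ : (((ρ_ N).hom ≫ ε[N]) ⊗ₘ act X) ≫ (λ_ X.X).hom =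
      (ε[N] ▷ 𝟙_ C ⊗ₘ 𝟙 N ▷ X.X) ≫ (λ_ (𝟙_ C)).hom ▷ (N ⊗ X.X) ≫ (λ_ (N ⊗ X.X)).hom ≫ act X := by
    rw [← rightUnitor_naturality, ← unitors_equal, MonoidalCategory.tensorHom_def, id_whiskerRight,
      tensorHom_id, Category.assoc, leftUnitor_naturality, comp_whiskerRight_assoc]
  simp only [tensorAct, act_unitMod, Category.assoc]
  rw [e₁, ← tensorμ_natural_left_assoc, ← leftUnitor_monoidal_assoc, tensorHom_id,
    ← comp_whiskerRight_assoc, ComonObj.counit_comul, MonoidalCategory.tensorHom_def]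
  simp

theorem tensorAct_rightUnitor (X : Mod C N) :
    tensorAct X (unitMod N) ≫ (ρ_ X.X).hom = N ◁ (ρ_ X.X).hom ≫ act X := by
  have e₁ : (act X ⊗ₘ ((ρ_ N).hom ≫ ε[N])) ≫ (ρ_ X.X).hom =
      (𝟙 N ▷ X.X ⊗ₘ ε[N] ▷ 𝟙_ C) ≫ (N ⊗ X.X) ◁ (λ_ (𝟙_ C)).hom ≫ (ρ_ (N ⊗ X.X)).hom ≫ act X := by
    rw [← rightUnitor_naturality, ← unitors_equal, ← rightUnitor_naturality]
    simp [MonoidalCategory.tensorHom_def']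
  simp only [tensorAct, act_unitMod, Category.assoc]
  rw [e₁, ← tensorμ_natural_left_assoc, ← rightUnitor_monoidal_assoc, id_tensorHom,
    ← comp_whiskerRight_assoc, ComonObj.comul_counit, MonoidalCategory.tensorHom_def]
  simp

/-- The tensor category structure on the category of modules over a bialgebra `N`: the tensor
product, unit object and coherence isomorphisms are those of `C` on underlying objects. -/
instance repMonoidal : MonoidalCategory (Mod C N) where
  tensorObj X Y := tensorMod X Y
  whiskerLeft X {Y Y'} f := homMk (M := tensorMod X Y) (M' := tensorMod X Y') (X.X ◁ f.hom) (by
    rw [act_tensorMod, act_tensorMod, ← id_tensorHom]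
    exact tensorAct_hom (𝟙 X) f)
  whiskerRight {X X'} f Y := homMk (M := tensorMod X Y) (M' := tensorMod X' Y) (f.hom ▷ Y.X) (by
    rw [act_tensorMod, act_tensorMod, ← tensorHom_id]
    exact tensorAct_hom f (𝟙 Y))
  tensorHom {X X' Y Y'} f g :=
    homMk (M := tensorMod X Y) (M' := tensorMod X' Y') (f.hom ⊗ₘ g.hom) (tensorAct_hom f g)
  tensorUnit := unitMod N
  associator X Y Z :=
    isoMk (M := tensorMod (tensorMod X Y) Z) (M' := tensorMod X (tensorMod Y Z))
      (α_ X.X Y.X Z.X) (tensorAct_assoc X Y Z)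
  leftUnitor X :=
    isoMk (M := tensorMod (unitMod N) X) (M' := X) (λ_ X.X) (tensorAct_leftUnitor X)
  rightUnitor X :=
    isoMk (M := tensorMod X (unitMod N)) (M' := X) (ρ_ X.X) (tensorAct_rightUnitor X)
  tensorHom_def f g := Mod.hom_ext _ _ (MonoidalCategory.tensorHom_def f.hom g.hom)
  id_tensorHom_id X Y := Mod.hom_ext _ _ (MonoidalCategory.id_tensorHom_id X.X Y.X)
  tensorHom_comp_tensorHom f₁ f₂ g₁ g₂ := Mod.hom_ext _ _
    (MonoidalCategory.tensorHom_comp_tensorHom f₁.hom f₂.hom g₁.hom g₂.hom)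
  whiskerLeft_id X Y := Mod.hom_ext _ _ (MonoidalCategory.whiskerLeft_id X.X Y.X)
  id_whiskerRight X Y := Mod.hom_ext _ _ (MonoidalCategory.id_whiskerRight X.X Y.X)
  associator_naturality f g h := Mod.hom_ext _ _
    (MonoidalCategory.associator_naturality f.hom g.hom h.hom)
  leftUnitor_naturality f := Mod.hom_ext _ _ (MonoidalCategory.leftUnitor_naturality f.hom)
  rightUnitor_naturality f := Mod.hom_ext _ _ (MonoidalCategory.rightUnitor_naturality f.hom)
  pentagon W X Y Z := Mod.hom_ext _ _ (MonoidalCategory.pentagon W.X X.X Y.X Z.X)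
  triangle X Y := Mod.hom_ext _ _ (MonoidalCategory.triangle X.X Y.X)

end Bialgebras

section Splitting

open Functor.LaxMonoidal Functor.OplaxMonoidal

variable {C : Type u₁} [Category.{v₁} C] [MonoidalCategory C] [BraidedCategory C]
  {B : Type u₂} [Category.{v₂} B] [MonoidalCategory B]

/-- A tensor functor `J` from `C` to the Drinfeld center of `B` is a braided functor on the category
`C` with the reversed braiding, whose component at `V, W` is `(c_{W,V})⁻¹ : V ⊗ W ⟶ W ⊗ V`.
The object `J V` of the center consists of an object `ι V` of `B` with a half-braiding
`c'_{V,M} : ι V ⊗ M ⟶ M ⊗ ι V`, and the braiding of the center at `J V, J W` is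
`c'_{V, ι W}`. -/
def IsBraidedOnReverse (J : C ⥤ Center B) [J.Monoidal] : Prop :=
  ∀ V W : C, μ J V W ≫ J.map (β_ W V).inv = (β_ (J.obj V) (J.obj W)).hom ≫ μ J W V

/-- The tensor functor `ι : C ⥤ B` underlying a functor to the Drinfeld center of `B`. -/
abbrev inclusion (J : C ⥤ Center B) : C ⥤ B := J ⋙ Center.forget B

/-- The condition `l(c') = c⁻¹`: under the tensor structure of `l` and `ξ : l ∘ ι ≅ id`, the image
of the half-braiding `c'_{V,M} : ι V ⊗ M ⟶ M ⊗ ι V` is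
`(c_{l M, V})⁻¹ : V ⊗ l M ⟶ l M ⊗ V`. -/
def MapsHalfBraidingToInverse (J : C ⥤ Center B) (l : B ⥤ C) [l.Monoidal]
    (ξ : inclusion J ⋙ l ≅ 𝟭 C) : Prop :=
  ∀ (V : C) (M : B),
    l.map ((J.obj V).2.β M).hom ≫ δ l M ((inclusion J).obj V) ≫ l.obj M ◁ ξ.hom.app V =
      δ l ((inclusion J).obj V) M ≫ ξ.hom.app V ▷ l.obj M ≫ (β_ (l.obj M) V).inv

/-- The structure of a functor of right `C`-module categories on `F : Rep(N)(C) ⥤ B`, the right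
`C`-module structures being `(M, V) ↦ M.V` and `(M, V) ↦ M ⊗ ι(V)`. It consists of natural
isomorphisms `F(M.V) ≅ F(M) ⊗ ι(V)` subject to the coherence axioms. -/
abbrev ModuleFunctorStructure {N : C} [MonObj N] (F : Mod C N ⥤ B) (ι : C ⥤ B) [ι.Monoidal] :=
  @Functor.RightLinear (Mod C N) B _ _ F C _ _ (repRightAction N) (rightActionAlong ι)

/-- The isomorphism `F(M.V) ⟶ F(M) ⊗ ι(V)` of a functor of module categories. -/
def ModuleFunctorStructure.map {N : C} [MonObj N] {F : Mod C N ⥤ B} {ι : C ⥤ B} [ι.Monoidal]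
    (FT : ModuleFunctorStructure F ι) (M : Mod C N) (V : C) :
    F.obj (actObj M V) ⟶ F.obj M ⊗ ι.obj V :=
  letI := repRightAction N
  letI := rightActionAlong ι
  FT.toOplaxRightLinear.δᵣ M V

/-- The image in `C` of the module functor structure of `F` is trivial: the composite
`l(F(M.V)) ⟶ l(F(M) ⊗ ι(V)) ⟶ l(F(M)) ⊗ l(ι(V)) ⟶ M ⊗ V` formed with the tensor structure of `l`,
with `ξ` and with `η` is the component of `η` at `M.V`, whose underlying object is `M ⊗ V`. -/
def IsTrivialUnder {N : C} [MonObj N] {F : Mod C N ⥤ B} {ι : C ⥤ B} [ι.Monoidal]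
    (FT : ModuleFunctorStructure F ι) (l : B ⥤ C) [l.Monoidal] (ξ : ι ⋙ l ≅ 𝟭 C)
    (η : F ⋙ l ≅ Mod.forget N) : Prop :=
  ∀ (M : Mod C N) (V : C),
    l.map (FT.map M V) ≫ δ l (F.obj M) (ι.obj V) ≫ l.obj (F.obj M) ◁ ξ.hom.app V ≫
      η.hom.app M ▷ V = η.hom.app (actObj M V)

end Splitting

end SplittingHopf

/-! Along `F`, every `l M` carries a natural action of `N`, and the linear maps between these
objects are exactly those coming from `B`. Triviality of the module functor structure says that `l
(M ⊗ ι V) ≅ l M ⊗ V` is linear, with `N` acting on the first factor only. The tensor product of `B`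
puts an action on each `l M ⊗ l M'` (`prodAct`). The point is that it is diagonal for a single
comultiplication, Δ(n) = n·(1 ⊗ 1) in the tensor square of the regular module (`prodAct_eq`).

The action N ⊗ l M → l M is itself a linear map out of a free module, so it comes from `B`, and
inserting the unit of `N` splits it in `C`. Hence n·(x ⊗ y) may be computed after writing x = 1·x
and y = 1·y. The free factor y splits off on the right (`prodAct_eq_unitAct`). The free factor x
must pass the second tensor factor by the half-braiding, which `l` turns into c⁻¹; moving x back
afterwards produces the c_{N,X} of the diagonal action (`unitAct_eq`).

The coherence isomorphisms of `B` now become linear maps between diagonal actions, and evaluating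
them on units gives the coalgebra axioms. The action axioms on N ⊗ N and on the unit object give the
bialgebra axioms. The lift of `l` to modules is then a monoidal equivalence, and `F` is inverse to
it.

In the rigid case, duals pass from `B` to modules. If X has a dual, adjunction shows that N ⊗ X with
the diagonal action is free on X, just like N.X. The comparison map is a fusion map, hence
invertible. The fusion maps on the two sides yield an antipode and a skew antipode, which are
mutually inverse. -/

namespace SplittingHopf

/-! ### Linear maps and diagonal actions. -/

section Intertwines

variable {C : Type u₁} [Category.{v₁} C] [MonoidalCategory C] {N X Y Z : C}

/-- The morphism `f` commutes with the (not necessarily associative) actions `a` and `b` of `N`. -/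
def Intertwines (a : N ⊗ X ⟶ X) (b : N ⊗ Y ⟶ Y) (f : X ⟶ Y) : Prop :=
  a ≫ f = N ◁ f ≫ b

namespace Intertwines

variable {a : N ⊗ X ⟶ X} {b : N ⊗ Y ⟶ Y} {c : N ⊗ Z ⟶ Z} {f : X ⟶ Y} {g : Y ⟶ Z}

theorem id (a : N ⊗ X ⟶ X) : Intertwines a a (𝟙 X) := by
  simp [Intertwines]

theorem comp (hf : Intertwines a b f) (hg : Intertwines b c g) : Intertwines a c (f ≫ g) := by
  unfold Intertwines at *
  rw [reassoc_of% hf, hg, whiskerLeft_comp_assoc]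

/-- `N ◁ f` is invertible with `f`, so it can be cancelled. This moves linearity across structure
isomorphisms such as `δ`. -/
theorem of_isIso_comp [IsIso f] (hf : Intertwines a b f) (hg : Intertwines a c (f ≫ g)) :
    Intertwines b c g := by
  unfold Intertwines at *
  rw [reassoc_of% hf, whiskerLeft_comp_assoc] at hg
  rwa [← cancel_epi (N ◁ f)]

theorem inv (e : X ≅ Y) (h : Intertwines a b e.hom) : Intertwines b a e.inv := by
  unfold Intertwines at *
  rw [Iso.comp_inv_eq, Category.assoc, h, ← whiskerLeft_comp_assoc]
  simp

theorem conj (a : N ⊗ X ⟶ X) (e : X ≅ Y) : Intertwines a (N ◁ e.inv ≫ a ≫ e.hom) e.hom := by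
  simp [Intertwines]

end Intertwines

/-- The action of `N` on `X ⊗ V` through the first factor. -/
def rightAct (a : N ⊗ X ⟶ X) (V : C) : N ⊗ (X ⊗ V) ⟶ X ⊗ V :=
  (α_ N X V).inv ≫ a ▷ V

theorem Intertwines.rightAct {a : N ⊗ X ⟶ X} {b : N ⊗ Y ⟶ Y} {f : X ⟶ Y}
    (h : Intertwines a b f) (V : C) :
    Intertwines (rightAct a V) (SplittingHopf.rightAct b V) (f ▷ V) := by
  unfold Intertwines SplittingHopf.rightAct at *
  rw [Category.assoc, ← comp_whiskerRight, h]
  simp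

variable [BraidedCategory C]

/-- The diagonal action of `N` on `X ⊗ Y` along a comultiplication `d`. -/
def diagAct (d : N ⟶ N ⊗ N) (a : N ⊗ X ⟶ X) (b : N ⊗ Y ⟶ Y) : N ⊗ (X ⊗ Y) ⟶ X ⊗ Y :=
  d ▷ (X ⊗ Y) ≫ tensorμ N N X Y ≫ (a ⊗ₘ b)

theorem Intertwines.diagAct {X' Y' : C} (d : N ⟶ N ⊗ N) {a : N ⊗ X ⟶ X} {b : N ⊗ Y ⟶ Y}
    {a' : N ⊗ X' ⟶ X'} {b' : N ⊗ Y' ⟶ Y'} {f : X ⟶ X'} {g : Y ⟶ Y'} (hf : Intertwines a a' f)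
    (hg : Intertwines b b' g) :
    Intertwines (diagAct d a b) (SplittingHopf.diagAct d a' b') (f ⊗ₘ g) := by
  unfold Intertwines SplittingHopf.diagAct at *
  rw [Category.assoc, Category.assoc, tensorHom_comp_tensorHom, hf, hg,
    ← tensorHom_comp_tensorHom, ← tensorμ_natural_right_assoc, whisker_exchange_assoc]

/-- The diagonal action on a pair of points is the comultiplication followed by the two orbit
maps. -/
theorem diagAct_point (d : N ⟶ N ⊗ N) (a : N ⊗ X ⟶ X) (b : N ⊗ Y ⟶ Y) (x : 𝟙_ C ⟶ X)
    (y : 𝟙_ C ⟶ Y) :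
    (ρ_ N).inv ≫ N ◁ ((λ_ (𝟙_ C)).inv ≫ (x ⊗ₘ y)) ≫ diagAct d a b =
      d ≫ (((ρ_ N).inv ≫ N ◁ x ≫ a) ⊗ₘ ((ρ_ N).inv ≫ N ◁ y ≫ b)) := by
  -- On points, the braiding inside `tensorμ` is one with the unit object, hence trivial.
  have h : (ρ_ (N ⊗ N)).inv ≫ (N ⊗ N) ◁ (λ_ (𝟙_ C)).inv ≫ tensorμ N N (𝟙_ C) (𝟙_ C) =
      ((ρ_ N).inv ⊗ₘ (ρ_ N).inv) := by
    simp only [tensorμ, braiding_tensorUnit_right]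
    monoidal
  unfold diagAct
  rw [whiskerLeft_comp_assoc, whisker_exchange_assoc, whisker_exchange_assoc,
    tensorμ_natural_right_assoc, tensorHom_comp_tensorHom, ← rightUnitor_inv_naturality_assoc,
    reassoc_of% h, tensorHom_comp_tensorHom]

/-- By naturality, the inverse braiding of a point with `Y` reduces to that of the unit object, so
moving `Y` to the far right just leaves both copies of `u` on its left. -/
theorem braid_point (u : 𝟙_ C ⟶ X) :
    (ρ_ Y).inv ≫ Y ◁ u ≫ ((λ_ Y).inv ≫ u ▷ Y) ▷ X ≫ (α_ X Y X).hom ≫ X ◁ (β_ X Y).inv ≫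
      (α_ X X Y).inv = (λ_ Y).inv ≫ ((λ_ (𝟙_ C)).inv ≫ (u ⊗ₘ u)) ▷ Y := by
  rw [whisker_exchange_assoc]
  simp only [comp_whiskerRight, Category.assoc]
  rw [associator_naturality_right_assoc,
    ← MonoidalCategory.whiskerLeft_comp_assoc, BraidedCategory.braiding_inv_naturality_right,
    MonoidalCategory.tensorHom_def]
  simp [braiding_inv_tensorUnit_left]

/-- The action of `N` on `X ⊗ R` on the unit of `R` is determined by its action on `R ⊗ R`, if the
action morphism `R ⊗ X ⟶ X` is linear and `X` splits off from `(R ⊗ X) ⊗ R` by the inverse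
braiding. -/
theorem orbit_eq_of_intertwines {R : C} (e : R ≅ N) (u : 𝟙_ C ⟶ R) (a : N ⊗ X ⟶ X)
    (hu : (λ_ X).inv ≫ u ▷ X ≫ e.hom ▷ X ≫ a = 𝟙 X)
    (r : N ⊗ (R ⊗ R) ⟶ R ⊗ R) (q : N ⊗ ((R ⊗ X) ⊗ R) ⟶ (R ⊗ X) ⊗ R) (x : N ⊗ (X ⊗ R) ⟶ X ⊗ R)
    (h₁ : Intertwines q x ((e.hom ▷ X ≫ a) ▷ R))
    (h₂ : Intertwines q (rightAct r X) ((α_ R X R).hom ≫ R ◁ (β_ R X).inv ≫ (α_ R R X).inv)) :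
    N ◁ ((ρ_ X).inv ≫ X ◁ u) ≫ x ≫ X ◁ e.hom =
      ((ρ_ N).inv ≫ N ◁ ((λ_ (𝟙_ C)).inv ≫ (u ⊗ₘ u)) ≫ r ≫ (e.hom ⊗ₘ e.hom)) ▷ X ≫
        (α_ N N X).hom ≫ N ◁ (β_ N X).hom ≫ (α_ N X N).inv ≫ a ▷ N := by
  have hq : q = N ◁ ((α_ _ _ _).hom ≫ R ◁ (β_ R X).inv ≫ (α_ _ _ _).inv) ≫ (α_ _ _ _).inv ≫
      r ▷ X ≫ (α_ _ _ _).hom ≫ R ◁ (β_ R X).hom ≫ (α_ _ _ _).inv := by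
    rw [Intertwines, rightAct] at h₂
    rw [← reassoc_of% h₂]
    simp
  have h₃ : (R ◁ (β_ R X).hom ≫ (α_ R X R).inv) ≫ (e.hom ▷ X ≫ a) ▷ R ≫ X ◁ e.hom =
      (e.hom ⊗ₘ (e.hom ▷ X)) ≫ N ◁ (β_ N X).hom ≫ (α_ N X N).inv ≫ a ▷ N := by
    rw [← whisker_exchange, MonoidalCategory.tensorHom_def']
    simp only [comp_whiskerRight, Category.assoc]
    rw [← associator_inv_naturality_right_assoc, ← MonoidalCategory.whiskerLeft_comp_assoc,
      ← BraidedCategory.braiding_naturality_left, ← associator_inv_naturality_left_assoc,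
      MonoidalCategory.whiskerLeft_comp_assoc, whisker_exchange_assoc]
  -- In elements: write x ⊗ u as the image of (u ⊗ x) ⊗ u, move x to the right with c⁻¹, let `r` act
  -- on u ⊗ u, and move x back with c.
  calc N ◁ ((ρ_ X).inv ≫ X ◁ u) ≫ x ≫ X ◁ e.hom
      = N ◁ ((ρ_ X).inv ≫ X ◁ u ≫ ((λ_ X).inv ≫ u ▷ X ≫ e.hom ▷ X ≫ a) ▷ R) ≫ x ≫
          X ◁ e.hom := by rw [hu]; simp
    _ = N ◁ ((ρ_ X).inv ≫ X ◁ u ≫ ((λ_ X).inv ≫ u ▷ X) ▷ R) ≫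
          (N ◁ (e.hom ▷ X ≫ a) ▷ R ≫ x) ≫ X ◁ e.hom := by
        simp only [MonoidalCategory.whiskerLeft_comp, comp_whiskerRight, Category.assoc]
    _ = N ◁ ((ρ_ X).inv ≫ X ◁ u ≫ ((λ_ X).inv ≫ u ▷ X) ▷ R ≫ (α_ R X R).hom ≫
          R ◁ (β_ R X).inv ≫ (α_ R R X).inv) ≫ (α_ _ _ _).inv ≫ r ▷ X ≫ (α_ _ _ _).hom ≫
          (R ◁ (β_ R X).hom ≫ (α_ _ _ _).inv) ≫ (e.hom ▷ X ≫ a) ▷ R ≫ X ◁ e.hom := by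
        rw [← h₁, hq]
        simp only [MonoidalCategory.whiskerLeft_comp, comp_whiskerRight, Category.assoc]
    _ = _ := by
        rw [braid_point, h₃, MonoidalCategory.tensorHom_def e.hom (e.hom ▷ X)]
        simp [MonoidalCategory.tensorHom_def e.hom e.hom]

end Intertwines

/-! ### Transport of the action along the equivalence. -/

section OfEquivalence

variable {C : Type u₁} [Category.{v₁} C] [MonoidalCategory C] {B : Type u₂} [Category.{v₂} B]
  {l : B ⥤ C} {N : C} [MonObj N] (F : Mod C N ⥤ B)

/-- The isomorphism of `l (F X)` with the object underlying the module `X`. -/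
def forgetIso (e : F ⋙ l ≅ Mod.forget N) (X : Mod C N) : l.obj (F.obj X) ≅ X.X := e.app X

theorem forgetIso_naturality {X Y : Mod C N} (f : X ⟶ Y) :
    l.map (F.map f) ≫ (forgetIso F e Y).hom = (forgetIso F e X).hom ≫ f.hom :=
  e.hom.naturality f

variable [F.IsEquivalence]

/-- Every object `M` of `B` is the image of a module under the equivalence `F`. -/
noncomputable def counitIso (M : B) : F.obj (F.inv.obj M) ≅ M := F.asEquivalence.counitIso.app M

theorem counitIso_naturality {M M' : B} (f : M ⟶ M') :
    f ≫ (counitIso F M').inv = (counitIso F M).inv ≫ F.map (F.inv.map f) :=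
  F.asEquivalence.counitIso.inv.naturality f

/-- The object `l M` is isomorphic to the object underlying the module corresponding to `M`. -/
noncomputable def underlyingIso (e : F ⋙ l ≅ Mod.forget N) (M : B) : l.obj M ≅ (F.inv.obj M).X :=
  l.mapIso (counitIso F M).symm ≪≫ forgetIso F e (F.inv.obj M)

variable (e : F ⋙ l ≅ Mod.forget N)

theorem underlyingIso_naturality {M M' : B} (f : M ⟶ M') :
    l.map f ≫ (underlyingIso F e M').hom =
      (underlyingIso F e M).hom ≫ (F.inv.map f).hom := by
  simp only [underlyingIso, Iso.trans_hom, Functor.mapIso_hom, Iso.symm_hom, Category.assoc]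
  rw [← forgetIso_naturality, ← l.map_comp_assoc, counitIso_naturality, l.map_comp_assoc]

/-- The action of `N` on `l M` transported from the module corresponding to `M`. -/
noncomputable def transportedAct (M : B) : N ⊗ l.obj M ⟶ l.obj M :=
  N ◁ (underlyingIso F e M).hom ≫ act (F.inv.obj M) ≫ (underlyingIso F e M).inv

theorem underlyingIso_intertwines (M : B) :
    Intertwines (transportedAct F e M) (act (F.inv.obj M)) (underlyingIso F e M).hom := by
  simp [Intertwines, transportedAct]

theorem transportedAct_naturality {M M' : B} (f : M ⟶ M') :
    Intertwines (transportedAct F e M) (transportedAct F e M') (l.map f) := by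
  have h : Intertwines (transportedAct F e M) (act (F.inv.obj M'))
      ((underlyingIso F e M).hom ≫ (F.inv.map f).hom) :=
    (underlyingIso_intertwines F e M).comp (act_hom _)
  have := h.comp ((underlyingIso_intertwines F e M').inv)
  rwa [← underlyingIso_naturality, Category.assoc, Iso.hom_inv_id, Category.comp_id] at this

/-- The triangle identity identifies the module reconstructed from `F.obj X` with `X` itself,
compatibly with `forgetIso`. -/
theorem transportedAct_obj (X : Mod C N) :
    Intertwines (transportedAct F e (F.obj X)) (act X) (forgetIso F e X).hom := by
  let u : F.inv.obj (F.obj X) ⟶ X := F.asEquivalence.unitIso.inv.app X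
  have hu : (counitIso F (F.obj X)).inv ≫ F.map u = 𝟙 (F.obj X) :=
    F.asEquivalence.counitInv_functor_comp X
  have h := (underlyingIso_intertwines F e (F.obj X)).comp (act_hom u)
  have hX : (underlyingIso F e (F.obj X)).hom ≫ u.hom = (forgetIso F e X).hom := by
    simp only [underlyingIso, Iso.trans_hom, Functor.mapIso_hom, Iso.symm_hom, Category.assoc]
    rw [← forgetIso_naturality, ← l.map_comp_assoc, hu, l.map_id, Category.id_comp]
  rwa [hX] at h

/-- A functor to `C` whose composite with an equivalence is the forgetful functor is faithful. -/
theorem faithful_of_forget {F : Mod C N ⥤ B} [F.IsEquivalence] (e : F ⋙ l ≅ Mod.forget N) :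
    l.Faithful where
  map_injective {M M' f g} h := by
    have hf := underlyingIso_naturality F e f
    rw [h, underlyingIso_naturality, cancel_epi] at hf
    exact F.inv.map_injective (Mod.hom_ext _ _ hf.symm)

end OfEquivalence

/-! ### The lift of `l` and its compatibility with the right action of `C`. -/

section LiftedAction

open Functor.LaxMonoidal Functor.OplaxMonoidal

variable {C : Type u₁} [Category.{v₁} C] [MonoidalCategory C]
  {B : Type u₂} [Category.{v₂} B] [MonoidalCategory B]

/-- The isomorphism `l(ι V) ≅ V`. -/
def retractIso {ι : C ⥤ B} {l : B ⥤ C} (ξ : ι ⋙ l ≅ 𝟭 C) (V : C) : l.obj (ι.obj V) ≅ V := ξ.app V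

/-- The isomorphism `l(M ⊗ ι V) ≅ l M ⊗ V`. -/
def splitIso {ι : C ⥤ B} {l : B ⥤ C} [l.Monoidal] (ξ : ι ⋙ l ≅ 𝟭 C) (M : B) (V : C) :
    l.obj (M ⊗ ι.obj V) ≅ l.obj M ⊗ V :=
  (Functor.Monoidal.μIso l M (ι.obj V)).symm ≪≫ whiskerLeftIso (l.obj M) (retractIso ξ V)

theorem splitIso_hom {ι : C ⥤ B} {l : B ⥤ C} [l.Monoidal] (ξ : ι ⋙ l ≅ 𝟭 C) (M : B) (V : C) :
    (splitIso ξ M V).hom = δ l M (ι.obj V) ≫ l.obj M ◁ (retractIso ξ V).hom := rfl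

theorem splitIso_naturality {ι : C ⥤ B} {l : B ⥤ C} [l.Monoidal] (ξ : ι ⋙ l ≅ 𝟭 C)
    {M M' : B} (f : M ⟶ M') (V : C) :
    l.map (f ▷ ι.obj V) ≫ (splitIso ξ M' V).hom = (splitIso ξ M V).hom ≫ l.map f ▷ V := by
  simp [splitIso_hom, whisker_exchange]

/-- A lift of `l : B ⥤ C` to an equivalence of `B` with the category of `N`-modules: natural actions
of `N` on the objects `l M`, such that the linear morphisms are those coming from `B` and every
module is of this form. The lift is compatible with the right actions of `C`. -/
structure LiftedAction {ι : C ⥤ B} (l : B ⥤ C) [l.Monoidal] (ξ : ι ⋙ l ≅ 𝟭 C)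
    (N : C) [MonObj N] where
  /-- The module `l M`. -/
  act (M : B) : N ⊗ l.obj M ⟶ l.obj M
  one_act (M : B) : MonObj.one ▷ l.obj M ≫ act M = (λ_ (l.obj M)).hom
  mul_act (M : B) : MonObj.mul ▷ l.obj M ≫ act M =
    (α_ N N (l.obj M)).hom ≫ N ◁ act M ≫ act M
  naturality {M M' : B} (f : M ⟶ M') : Intertwines (act M) (act M') (l.map f)
  exists_map {M M' : B} (g : l.obj M ⟶ l.obj M') (hg : Intertwines (act M) (act M') g) :
    ∃ f : M ⟶ M', l.map f = g
  exists_obj (X : Mod C N) :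
    ∃ (M : B) (e : l.obj M ≅ X.X), Intertwines (act M) (SplittingHopf.act X) e.hom
  splitIso_intertwines (M : B) (V : C) :
    Intertwines (act (M ⊗ ι.obj V)) (rightAct (act M) V) (splitIso ξ M V).hom

variable {ι : C ⥤ B} [ι.Monoidal] {l : B ⥤ C} [l.Monoidal] (ξ : ι ⋙ l ≅ 𝟭 C)
  {N : C} [MonObj N] (F : Mod C N ⥤ B) [F.IsEquivalence] (e : F ⋙ l ≅ Mod.forget N)

variable (FT : ModuleFunctorStructure F ι)

/-- Triviality factors `forgetIso` at X.V as `l` of the structure map of `F`, then `splitIso`, then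
`forgetIso` at X tensored with V. The first is linear because it comes from `B`, the last because
`N` acts on the first factor; cancelling both leaves `splitIso`. -/
theorem splitIso_transportedAct_obj (hFT : IsTrivialUnder FT l ξ e) (X : Mod C N) (V : C) :
    Intertwines (transportedAct F e (F.obj X ⊗ ι.obj V)) (rightAct (transportedAct F e (F.obj X)) V)
      (splitIso ξ (F.obj X) V).hom := by
  have hi : IsIso (FT.map X V) := by
    let _ := repRightAction N
    let _ := rightActionAlong ι
    exact inferInstanceAs (IsIso (FT.toOplaxRightLinear.δᵣ X V))
  have h₁ := transportedAct_obj F e (actObj X V)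
  have h₀ : (forgetIso F e (actObj X V)).hom = l.map (FT.map X V) ≫
      (splitIso ξ (F.obj X) V).hom ≫ (forgetIso F e X).hom ▷ V := by
    rw [splitIso_hom, Category.assoc]
    exact (hFT X V).symm
  rw [h₀] at h₁
  have h₂ := (transportedAct_naturality F e (FT.map X V)).of_isIso_comp h₁
  have h₃ := h₂.comp (((transportedAct_obj F e X).inv (forgetIso F e X)).rightAct V)
  rwa [Category.assoc, hom_inv_whiskerRight, Category.comp_id] at h₃

theorem splitIso_transportedAct (hFT : IsTrivialUnder FT l ξ e) (M : B) (V : C) :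
    Intertwines (transportedAct F e (M ⊗ ι.obj V)) (rightAct (transportedAct F e M) V)
      (splitIso ξ M V).hom := by
  let c : F.obj (F.inv.obj M) ≅ M := counitIso F M
  have h := (splitIso_transportedAct_obj ξ F e FT hFT (F.inv.obj M) V).comp
    ((transportedAct_naturality F e c.hom).rightAct V)
  rw [← splitIso_naturality] at h
  exact (transportedAct_naturality F e (c.hom ▷ ι.obj V)).of_isIso_comp h

/-- The lift of `l` given by an equivalence `F` with the category of modules such that `F ⋙ l` is
the forgetful functor. -/
noncomputable def liftedAction (hFT : IsTrivialUnder FT l ξ e) : LiftedAction l ξ N where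
  act M := transportedAct F e M
  one_act M := by
    rw [transportedAct, ← whisker_exchange_assoc, reassoc_of% act_one]
    simp
  mul_act M := by
    simp only [transportedAct]
    rw [← whisker_exchange_assoc, reassoc_of% act_mul]
    simp
  naturality f := transportedAct_naturality F e f
  exists_map {M M'} g hg := by
    have h : act (F.inv.obj M) ≫ (underlyingIso F e M).inv ≫ g ≫ (underlyingIso F e M').hom =
        N ◁ ((underlyingIso F e M).inv ≫ g ≫ (underlyingIso F e M').hom) ≫
          act (F.inv.obj M') :=
      ((underlyingIso_intertwines F e M).inv).comp
        (hg.comp (underlyingIso_intertwines F e M'))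
    refine ⟨F.inv.preimage (homMk _ h), ?_⟩
    rw [← cancel_mono (underlyingIso F e M').hom, underlyingIso_naturality]
    simp
  exists_obj X := ⟨F.obj X, forgetIso F e X, transportedAct_obj F e X⟩
  splitIso_intertwines M V := splitIso_transportedAct ξ F e FT hFT M V

end LiftedAction

/-! ### The action on tensor products and its comultiplication. -/

namespace LiftedAction

open Functor.LaxMonoidal Functor.OplaxMonoidal

variable {C : Type u₁} [Category.{v₁} C] [MonoidalCategory C]
  {B : Type u₂} [Category.{v₂} B] [MonoidalCategory B]
  {ι : C ⥤ B} {l : B ⥤ C} [l.Monoidal] {ξ : ι ⋙ l ≅ 𝟭 C} {N : C} [MonObj N]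
  (A : LiftedAction l ξ N)

/-- The object of `B` corresponding to the regular module. -/
noncomputable def regularObj : B := (A.exists_obj (Mod.regular N)).choose

/-- The isomorphism of `l P` with `N`, where `P` corresponds to the regular module. -/
noncomputable def regularIso : l.obj A.regularObj ≅ N :=
  (A.exists_obj (Mod.regular N)).choose_spec.choose

theorem regularIso_intertwines :
    Intertwines (A.act A.regularObj) (MonObj.mul : N ⊗ N ⟶ N) A.regularIso.hom :=
  (A.exists_obj (Mod.regular N)).choose_spec.choose_spec

/-- The action of `N` on `l M ⊗ l M'` given by the tensor product of `B`. -/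
def prodAct (M M' : B) : N ⊗ (l.obj M ⊗ l.obj M') ⟶ l.obj M ⊗ l.obj M' :=
  N ◁ μ l M M' ≫ A.act (M ⊗ M') ≫ δ l M M'

theorem δ_intertwines (M M' : B) :
    Intertwines (A.act (M ⊗ M')) (A.prodAct M M') (δ l M M') := by
  simp [Intertwines, prodAct, ← MonoidalCategory.whiskerLeft_comp_assoc]

theorem prodAct_naturality {M M' K K' : B} (f : M ⟶ M') (g : K ⟶ K') :
    Intertwines (A.prodAct M K) (A.prodAct M' K') (l.map f ⊗ₘ l.map g) := by
  have h := (A.naturality (f ⊗ₘ g)).comp (A.δ_intertwines M' K')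
  rw [← δ_natural] at h
  exact (A.δ_intertwines M K).of_isIso_comp h

theorem δ_splitIso (M M' : B) (V : C) :
    δ l M (M' ⊗ ι.obj V) ≫ l.obj M ◁ (splitIso ξ M' V).hom ≫ (α_ (l.obj M) (l.obj M') V).inv =
      l.map (α_ M M' (ι.obj V)).inv ≫ (splitIso ξ (M ⊗ M') V).hom ≫ δ l M M' ▷ V := by
  have h₂ := Functor.OplaxMonoidal.associativity_inv l M M' (ι.obj V)
  simp only [splitIso_hom, Category.assoc, MonoidalCategory.whiskerLeft_comp]
  rw [whisker_exchange, ← reassoc_of% h₂, associator_inv_naturality_right]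

/-- On a product with `M' ⊗ ι V`, the object `V` splits off on the right. -/
theorem prodAct_right (M M' : B) (V : C) :
    Intertwines (A.prodAct M (M' ⊗ ι.obj V)) (rightAct (A.prodAct M M') V)
      (l.obj M ◁ (splitIso ξ M' V).hom ≫ (α_ (l.obj M) (l.obj M') V).inv) := by
  refine (A.δ_intertwines M (M' ⊗ ι.obj V)).of_isIso_comp ?_
  rw [δ_splitIso]
  exact (A.naturality (α_ M M' (ι.obj V)).inv).comp
    ((A.splitIso_intertwines (M ⊗ M') V).comp ((A.δ_intertwines M M').rightAct V))

/-- A linear morphism `N.(l M) ⟶ l M`, given by the action, comes from `B`. -/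
theorem exists_map_act (M : B) : ∃ p : A.regularObj ⊗ ι.obj (l.obj M) ⟶ M,
    l.map p = (splitIso ξ A.regularObj (l.obj M)).hom ≫ A.regularIso.hom ▷ l.obj M ≫ A.act M := by
  apply A.exists_map
  refine (A.splitIso_intertwines _ _).comp ((A.regularIso_intertwines.rightAct _).comp ?_)
  -- Associativity of the action says that the action map out of the free module is linear.
  simp [Intertwines, rightAct, A.mul_act]

/-- The unit of `N` as a point of `l P`. -/
noncomputable def unitPoint : 𝟙_ C ⟶ l.obj A.regularObj := MonObj.one ≫ A.regularIso.inv

/-- The splitting y ↦ 1 ⊗ y of the action map; it lives in `C` and need not be linear. -/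
theorem unitPoint_act (M : B) :
    (λ_ (l.obj M)).inv ≫ A.unitPoint ▷ l.obj M ≫ A.regularIso.hom ▷ l.obj M ≫ A.act M =
      𝟙 (l.obj M) := by
  rw [← comp_whiskerRight_assoc, unitPoint, Category.assoc, Iso.inv_hom_id, Category.comp_id,
    A.one_act, Iso.inv_hom_id]

/-- The morphism `N ⊗ l M ⟶ l M ⊗ N` given by the action of `N` on the tensor product of `M` and
the regular module, applied to the unit of the regular module. -/
noncomputable def unitAct (M : B) : N ⊗ l.obj M ⟶ l.obj M ⊗ N :=
  N ◁ ((ρ_ (l.obj M)).inv ≫ l.obj M ◁ A.unitPoint) ≫ A.prodAct M A.regularObj ≫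
    l.obj M ◁ A.regularIso.hom

/-- Write y = 1·y. In the product with the free module on `l M'`, that object splits off on the
right, so only n·(x ⊗ 1) matters; applying `p` lets its `N`-component act on y. -/
theorem prodAct_eq_unitAct (M M' : B) :
    A.prodAct M M' = (α_ N (l.obj M) (l.obj M')).inv ≫ A.unitAct M ▷ l.obj M' ≫
      (α_ (l.obj M) N (l.obj M')).hom ≫ l.obj M ◁ A.act M' := by
  obtain ⟨p, hp⟩ := A.exists_map_act M'
  let s : l.obj M' ⟶ l.obj (A.regularObj ⊗ ι.obj (l.obj M')) :=
    (λ_ (l.obj M')).inv ≫ A.unitPoint ▷ l.obj M' ≫ (splitIso ξ A.regularObj (l.obj M')).inv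
  have hs : s ≫ l.map p = 𝟙 _ := by
    rw [hp]
    simpa [s] using A.unitPoint_act M'
  have hs' : s ≫ (splitIso ξ A.regularObj (l.obj M')).hom =
      (λ_ (l.obj M')).inv ≫ A.unitPoint ▷ l.obj M' := by simp [s]
  have h₁ := A.prodAct_naturality (𝟙 M) p
  rw [l.map_id, id_tensorHom, Intertwines] at h₁
  have h₂ := A.prodAct_right M A.regularObj (l.obj M')
  rw [Intertwines, rightAct] at h₂
  have h₃ : A.prodAct M (A.regularObj ⊗ ι.obj (l.obj M')) ≫ l.obj M ◁ l.map p =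
      N ◁ (l.obj M ◁ (splitIso ξ A.regularObj (l.obj M')).hom ≫ (α_ _ _ _).inv) ≫
        (α_ _ _ _).inv ≫ A.prodAct M A.regularObj ▷ l.obj M' ≫
          (α_ _ _ _).hom ≫ l.obj M ◁ (A.regularIso.hom ▷ l.obj M' ≫ A.act M') := by
    rw [← reassoc_of% h₂, hp]
    simp
  calc A.prodAct M M' = N ◁ l.obj M ◁ (s ≫ l.map p) ≫ A.prodAct M M' := by simp [hs]
    _ = N ◁ l.obj M ◁ s ≫ A.prodAct M (A.regularObj ⊗ ι.obj (l.obj M')) ≫ l.obj M ◁ l.map p := by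
        rw [h₁]; simp
    _ = _ := by
        rw [h₃, ← MonoidalCategory.whiskerLeft_comp_assoc,
          ← MonoidalCategory.whiskerLeft_comp_assoc, hs', unitAct]
        simp [-Functor.OplaxMonoidal.left_unitality, -Functor.OplaxMonoidal.right_unitality]

/-- The comultiplication of `N`: the action of `N` on the tensor square of the regular module,
applied to the units. -/
noncomputable def comul : N ⟶ N ⊗ N :=
  (ρ_ N).inv ≫ N ◁ ((λ_ (𝟙_ C)).inv ≫ (A.unitPoint ⊗ₘ A.unitPoint)) ≫
    A.prodAct A.regularObj A.regularObj ≫ (A.regularIso.hom ⊗ₘ A.regularIso.hom)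

/-- The counit of `N`: the action of `N` on the unit object. -/
def counit : N ⟶ 𝟙_ C :=
  (ρ_ N).inv ≫ N ◁ ε l ≫ A.act (𝟙_ B) ≫ η l

theorem η_intertwines : Intertwines (A.act (𝟙_ B)) ((ρ_ N).hom ≫ A.counit) (η l) := by
  simp [Intertwines, counit, ← MonoidalCategory.whiskerLeft_comp_assoc]

variable [BraidedCategory C]

/-- The objects `ι V` have half-braidings in `B` that `l` maps to the inverse braiding. -/
def HasSplitBraiding (ξ : ι ⋙ l ≅ 𝟭 C) : Prop :=
  ∀ (V : C) (M : B), ∃ c : ι.obj V ⊗ M ⟶ M ⊗ ι.obj V,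
    l.map c ≫ (splitIso ξ M V).hom =
      δ l (ι.obj V) M ≫ (retractIso ξ V).hom ▷ l.obj M ≫ (β_ (l.obj M) V).inv

/-- On a product with `M ⊗ ι V` on the left, the object `V` splits off on the right. -/
theorem prodAct_left (hξ : HasSplitBraiding ξ) (M M' : B) (V : C) :
    Intertwines (A.prodAct (M ⊗ ι.obj V) M') (rightAct (A.prodAct M M') V)
      ((splitIso ξ M V).hom ▷ l.obj M' ≫ (α_ (l.obj M) V (l.obj M')).hom ≫
        l.obj M ◁ (β_ (l.obj M') V).inv ≫ (α_ (l.obj M) (l.obj M') V).inv) := by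
  obtain ⟨c, hc⟩ := hξ V M'
  -- Moving `ι V` past `M'` by `c` happens in `B`, so it is linear under `l`; it then remains to
  -- split `V` off `M ⊗ M'`.
  have h : δ l (M ⊗ ι.obj V) M' ≫ (splitIso ξ M V).hom ▷ l.obj M' ≫
      (α_ (l.obj M) V (l.obj M')).hom ≫ l.obj M ◁ (β_ (l.obj M') V).inv ≫
        (α_ (l.obj M) (l.obj M') V).inv =
      l.map ((α_ M (ι.obj V) M').hom ≫ M ◁ c ≫ (α_ M M' (ι.obj V)).inv) ≫
        (splitIso ξ (M ⊗ M') V).hom ≫ δ l M M' ▷ V := by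
    simp only [l.map_comp, Category.assoc]
    rw [← δ_splitIso, ← δ_natural_right_assoc, ← MonoidalCategory.whiskerLeft_comp_assoc, hc]
    simp only [MonoidalCategory.whiskerLeft_comp, Category.assoc]
    rw [← Functor.OplaxMonoidal.associativity_assoc]
    simp [splitIso_hom]
  refine (A.δ_intertwines _ _).of_isIso_comp ?_
  rw [h]
  exact (A.naturality _).comp
    ((A.splitIso_intertwines (M ⊗ M') V).comp ((A.δ_intertwines M M').rightAct V))

/-- The same device in the first variable: x = 1·x reduces n·(x ⊗ 1) to n·(1 ⊗ 1), at the price of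
braiding x past the second regular module and back. -/
theorem unitAct_eq (hξ : HasSplitBraiding ξ) (M : B) :
    A.unitAct M = A.comul ▷ l.obj M ≫ (α_ N N (l.obj M)).hom ≫ N ◁ (β_ N (l.obj M)).hom ≫
      (α_ N (l.obj M) N).inv ≫ A.act M ▷ N := by
  obtain ⟨p, hp⟩ := A.exists_map_act M
  let t := whiskerRightIso (splitIso ξ A.regularObj (l.obj M)) (l.obj A.regularObj)
  have ht := Intertwines.conj (A.prodAct (A.regularObj ⊗ ι.obj (l.obj M)) A.regularObj) t
  refine orbit_eq_of_intertwines A.regularIso A.unitPoint (A.act M) (A.unitPoint_act M)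
    (A.prodAct A.regularObj A.regularObj) _ (A.prodAct M A.regularObj)
    (ht.of_isIso_comp ?_) (ht.of_isIso_comp (A.prodAct_left hξ _ _ _))
  have h := A.prodAct_naturality p (𝟙 A.regularObj)
  rwa [l.map_id, tensorHom_id, hp, comp_whiskerRight] at h

theorem prodAct_eq (hξ : HasSplitBraiding ξ) (M M' : B) :
    A.prodAct M M' = diagAct A.comul (A.act M) (A.act M') := by
  rw [prodAct_eq_unitAct, unitAct_eq A hξ, diagAct, tensorμ, MonoidalCategory.tensorHom_def]
  simp

theorem δ_intertwines_diagAct (hξ : HasSplitBraiding ξ) (M M' : B) :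
    Intertwines (A.act (M ⊗ M')) (diagAct A.comul (A.act M) (A.act M')) (δ l M M') := by
  rw [← A.prodAct_eq hξ]
  exact A.δ_intertwines M M'

/-- Through `δ`, the associator of `C` is `l` of the associator of `B`, and every map from `B` is
linear. The unitors below work alike. -/
theorem diagAct_assoc (hξ : HasSplitBraiding ξ) (M M' M'' : B) :
    Intertwines (diagAct A.comul (diagAct A.comul (A.act M) (A.act M')) (A.act M''))
      (diagAct A.comul (A.act M) (diagAct A.comul (A.act M') (A.act M'')))
      (α_ (l.obj M) (l.obj M') (l.obj M'')).hom := by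
  have h₁ := (A.δ_intertwines_diagAct hξ (M ⊗ M') M'').comp
    ((A.δ_intertwines_diagAct hξ M M').diagAct A.comul
      (Intertwines.id (A.act M'')))
  refine h₁.of_isIso_comp ?_
  have h₂ := (A.naturality (α_ M M' M'').hom).comp
    ((A.δ_intertwines_diagAct hξ M (M' ⊗ M'')).comp
      ((Intertwines.id (A.act M)).diagAct A.comul (A.δ_intertwines_diagAct hξ M' M'')))
  convert h₂ using 1
  simp

theorem diagAct_leftUnitor (hξ : HasSplitBraiding ξ) (M : B) :
    Intertwines (diagAct A.comul ((ρ_ N).hom ≫ A.counit) (A.act M)) (A.act M)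
      (λ_ (l.obj M)).hom := by
  refine ((A.δ_intertwines_diagAct hξ (𝟙_ B) M).comp
    (A.η_intertwines.diagAct A.comul (Intertwines.id _))).of_isIso_comp ?_
  convert A.naturality (λ_ M).hom using 1
  simp

theorem diagAct_rightUnitor (hξ : HasSplitBraiding ξ) (M : B) :
    Intertwines (diagAct A.comul (A.act M) ((ρ_ N).hom ≫ A.counit)) (A.act M)
      (ρ_ (l.obj M)).hom := by
  refine ((A.δ_intertwines_diagAct hξ M (𝟙_ B)).comp
    ((Intertwines.id _).diagAct A.comul A.η_intertwines)).of_isIso_comp ?_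
  convert A.naturality (ρ_ M).hom using 1
  simp

/-! ### Coalgebra and bialgebra axioms by evaluation on units. -/

open scoped MonObj

theorem diagAct_regular_assoc (hξ : HasSplitBraiding ξ) :
    Intertwines (diagAct A.comul (diagAct A.comul μ[N] μ[N]) μ[N])
      (diagAct A.comul μ[N] (diagAct A.comul μ[N] μ[N])) (α_ N N N).hom := by
  have e := A.regularIso_intertwines
  refine ((e.diagAct A.comul e).diagAct A.comul e).of_isIso_comp ?_
  convert (A.diagAct_assoc hξ _ _ _).comp (e.diagAct A.comul (e.diagAct A.comul e)) using 1
  simp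

theorem diagAct_regular_leftUnitor (hξ : HasSplitBraiding ξ) :
    Intertwines (diagAct A.comul ((ρ_ N).hom ≫ A.counit) μ[N]) μ[N] (λ_ N).hom := by
  have e := A.regularIso_intertwines
  refine ((Intertwines.id _).diagAct A.comul e).of_isIso_comp ?_
  convert (A.diagAct_leftUnitor hξ _).comp e using 1
  simp

theorem diagAct_regular_rightUnitor (hξ : HasSplitBraiding ξ) :
    Intertwines (diagAct A.comul μ[N] ((ρ_ N).hom ≫ A.counit)) μ[N] (ρ_ N).hom := by
  have e := A.regularIso_intertwines
  refine (e.diagAct A.comul (Intertwines.id _)).of_isIso_comp ?_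
  convert (A.diagAct_rightUnitor hξ _).comp e using 1
  simp

theorem diagAct_regular_point :
    (ρ_ N).inv ≫ N ◁ ((λ_ (𝟙_ C)).inv ≫ (η[N] ⊗ₘ η[N])) ≫ diagAct A.comul μ[N] μ[N] =
      A.comul := by
  rw [diagAct_point]
  simp

/-- Linearity of the left unitor, applied to n·(1 ⊗ `η[N]`) in the product of the trivial and the
regular module. -/
theorem comul_leftUnitor (hξ : HasSplitBraiding ξ) :
    A.comul ≫ A.counit ▷ N = (λ_ N).inv := by
  have h := diagAct_point A.comul ((ρ_ N).hom ≫ A.counit) μ[N] (𝟙 _) η[N]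
  rw [← cancel_mono (λ_ N).hom] at h ⊢
  simp only [Category.assoc] at h
  have hη : ((λ_ (𝟙_ C)).inv ≫ (𝟙 (𝟙_ C) ⊗ₘ η[N])) ≫ (λ_ N).hom = η[N] := by simp
  rw [A.diagAct_regular_leftUnitor hξ, ← whiskerLeft_comp_assoc, hη] at h
  simpa [MonoidalCategory.tensorHom_def] using h.symm

theorem comul_rightUnitor (hξ : HasSplitBraiding ξ) :
    A.comul ≫ N ◁ A.counit = (ρ_ N).inv := by
  have h := diagAct_point A.comul μ[N] ((ρ_ N).hom ≫ A.counit) η[N] (𝟙 _)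
  rw [← cancel_mono (ρ_ N).hom] at h ⊢
  simp only [Category.assoc] at h
  have hη : ((λ_ (𝟙_ C)).inv ≫ (η[N] ⊗ₘ 𝟙 (𝟙_ C))) ≫ (ρ_ N).hom = η[N] := by
    simp [unitors_inv_equal]
  rw [A.diagAct_regular_rightUnitor hξ, ← whiskerLeft_comp_assoc, hη] at h
  simpa [MonoidalCategory.tensorHom_def'] using h.symm

/-- The two sides are n·((1 ⊗ 1) ⊗ 1), reassociated, and n·(1 ⊗ (1 ⊗ 1)); the associator is linear
and matches the points. -/
theorem comul_associator (hξ : HasSplitBraiding ξ) :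
    A.comul ≫ A.comul ▷ N ≫ (α_ N N N).hom = A.comul ≫ N ◁ A.comul := by
  have h₁ := diagAct_point A.comul (diagAct A.comul μ[N] μ[N]) μ[N]
    ((λ_ (𝟙_ C)).inv ≫ (η[N] ⊗ₘ η[N])) η[N]
  have h₂ := diagAct_point A.comul μ[N] (diagAct A.comul μ[N] μ[N])
    η[N] ((λ_ (𝟙_ C)).inv ≫ (η[N] ⊗ₘ η[N]))
  have hη : ((λ_ (𝟙_ C)).inv ≫ (((λ_ (𝟙_ C)).inv ≫ (η[N] ⊗ₘ η[N])) ⊗ₘ η[N])) ≫ (α_ N N N).hom =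
      (λ_ (𝟙_ C)).inv ≫ (η[N] ⊗ₘ ((λ_ (𝟙_ C)).inv ≫ (η[N] ⊗ₘ η[N]))) := by
    simp only [MonoidalCategory.tensorHom_def]
    monoidal
  rw [A.diagAct_regular_point] at h₁ h₂
  simp only [MonObj.mul_one, Iso.inv_hom_id, tensorHom_id, id_tensorHom] at h₁ h₂
  rw [← h₂, ← reassoc_of% h₁, A.diagAct_regular_assoc hξ, ← whiskerLeft_comp_assoc, hη]

/-- The coalgebra structure on `N`. -/
@[reducible]
noncomputable def comonObj (hξ : HasSplitBraiding ξ) : ComonObj N where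
  counit := A.counit
  comul := A.comul
  counit_comul := A.comul_leftUnitor hξ
  comul_counit := A.comul_rightUnitor hξ
  comul_assoc := (A.comul_associator hξ).symm

/-- Through `f`, this diagonal action is conjugate to a genuine module structure, so it satisfies
the action axioms before any bialgebra axiom is known. -/
theorem one_diagAct (hξ : HasSplitBraiding ξ) :
    η[N] ▷ (N ⊗ N) ≫ diagAct A.comul μ[N] μ[N] = (λ_ (N ⊗ N)).hom := by
  have e := (A.δ_intertwines_diagAct hξ A.regularObj A.regularObj).comp
    (A.regularIso_intertwines.diagAct A.comul A.regularIso_intertwines)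
  let f := δ l A.regularObj A.regularObj ≫ (A.regularIso.hom ⊗ₘ A.regularIso.hom)
  rw [← cancel_epi (𝟙_ C ◁ f), whisker_exchange_assoc, ← e, reassoc_of% A.one_act]
  simp [f]

theorem mul_diagAct (hξ : HasSplitBraiding ξ) :
    μ[N] ▷ (N ⊗ N) ≫ diagAct A.comul μ[N] μ[N] =
      (α_ N N (N ⊗ N)).hom ≫ N ◁ diagAct A.comul μ[N] μ[N] ≫ diagAct A.comul μ[N] μ[N] := by
  have e := (A.δ_intertwines_diagAct hξ A.regularObj A.regularObj).comp
    (A.regularIso_intertwines.diagAct A.comul A.regularIso_intertwines)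
  let f := δ l A.regularObj A.regularObj ≫ (A.regularIso.hom ⊗ₘ A.regularIso.hom)
  change A.act _ ≫ f = N ◁ f ≫ _ at e
  rw [← cancel_epi ((N ⊗ N) ◁ f), whisker_exchange_assoc, ← e, reassoc_of% A.mul_act,
    associator_naturality_right_assoc, ← whiskerLeft_comp_assoc, ← e, whiskerLeft_comp_assoc, ← e]

omit [BraidedCategory C] in
theorem one_counitAct : η[N] ▷ 𝟙_ C ≫ (ρ_ N).hom ≫ A.counit = (λ_ (𝟙_ C)).hom := by
  have e := A.η_intertwines
  rw [← cancel_epi (𝟙_ C ◁ Functor.OplaxMonoidal.η l), whisker_exchange_assoc, ← e,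
    reassoc_of% A.one_act]
  simp

omit [BraidedCategory C] in
theorem mul_counitAct :
    μ[N] ▷ 𝟙_ C ≫ (ρ_ N).hom ≫ A.counit =
      (α_ N N (𝟙_ C)).hom ≫ N ◁ ((ρ_ N).hom ≫ A.counit) ≫ (ρ_ N).hom ≫ A.counit := by
  have e := A.η_intertwines
  rw [Intertwines] at e
  rw [← cancel_epi ((N ⊗ N) ◁ Functor.OplaxMonoidal.η l), whisker_exchange_assoc, ← e,
    reassoc_of% A.mul_act, associator_naturality_right_assoc, ← whiskerLeft_comp_assoc, ← e,
    whiskerLeft_comp_assoc, ← e]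

theorem isBialgebra (hξ : HasSplitBraiding ξ) :
    letI := A.comonObj hξ
    IsBialgebra N :=
  letI := A.comonObj hξ
  { mul_comul := by
      have h := A.mul_diagAct hξ
      have h' := congrArg (fun t => (ρ_ (N ⊗ N)).inv ≫
        (N ⊗ N) ◁ ((λ_ (𝟙_ C)).inv ≫ (η[N] ⊗ₘ η[N])) ≫ t) h
      have hp := A.diagAct_regular_point
      -- Evaluate (gh)·(1 ⊗ 1) = g·(h·(1 ⊗ 1)): the left side is Δ(gh), the right side g·Δ(h) =
      -- Δ(g)Δ(h).
      calc μ[N] ≫ A.comul = (ρ_ (N ⊗ N)).inv ≫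
            (N ⊗ N) ◁ ((λ_ (𝟙_ C)).inv ≫ (η[N] ⊗ₘ η[N])) ≫ μ[N] ▷ (N ⊗ N) ≫
              diagAct A.comul μ[N] μ[N] := by
            rw [whisker_exchange_assoc, ← rightUnitor_inv_naturality_assoc, hp]
        _ = N ◁ ((ρ_ N).inv ≫ N ◁ ((λ_ (𝟙_ C)).inv ≫ (η[N] ⊗ₘ η[N])) ≫
              diagAct A.comul μ[N] μ[N]) ≫ diagAct A.comul μ[N] μ[N] := by
            rw [h', associator_naturality_right_assoc]
            simp only [MonoidalCategory.whiskerLeft_comp, Category.assoc]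
            monoidal
        _ = _ := by
            rw [hp, diagAct, ← Category.assoc, ← MonoidalCategory.tensorHom_def']
            rfl
    one_comul := by
      have h := A.one_diagAct hξ
      have hp := A.diagAct_regular_point
      calc η[N] ≫ A.comul = (ρ_ (𝟙_ C)).inv ≫
            𝟙_ C ◁ ((λ_ (𝟙_ C)).inv ≫ (η[N] ⊗ₘ η[N])) ≫ η[N] ▷ (N ⊗ N) ≫
              diagAct A.comul μ[N] μ[N] := by
            rw [whisker_exchange_assoc, ← rightUnitor_inv_naturality_assoc, hp]
        _ = _ := by
            rw [h, leftUnitor_naturality]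
            simp [← unitors_inv_equal]
    mul_counit := by
      have h := congrArg (fun t => (ρ_ (N ⊗ N)).inv ≫ t) A.mul_counitAct
      change μ[N] ≫ A.counit = (A.counit ⊗ₘ A.counit) ≫ (λ_ (𝟙_ C)).hom
      rw [MonoidalCategory.tensorHom_def', Category.assoc, unitors_equal, rightUnitor_naturality]
      simpa using h
    one_counit := by
      have h := congrArg (fun t => (ρ_ (𝟙_ C)).inv ≫ t) A.one_counitAct
      change η[N] ≫ A.counit = 𝟙 _
      simpa [unitors_equal] using h }

end LiftedAction

/-! ### The lift as a monoidal equivalence. -/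

namespace LiftedAction

open Functor.LaxMonoidal Functor.OplaxMonoidal

variable {C : Type u₁} [Category.{v₁} C] [MonoidalCategory C]
  {B : Type u₂} [Category.{v₂} B] [MonoidalCategory B]
  {ι : C ⥤ B} {l : B ⥤ C} [l.Monoidal] {ξ : ι ⋙ l ≅ 𝟭 C} {N : C} [MonObj N]
  (A : LiftedAction l ξ N)

/-- The module `l M`. -/
def liftObj (M : B) : Mod C N := modMk (l.obj M) (A.act M) (A.one_act M) (A.mul_act M)

/-- The functor from `B` to the category of `N`-modules that lifts `l`. -/
def lift : B ⥤ Mod C N where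
  obj M := A.liftObj M
  map {M M'} f := homMk (M := A.liftObj M) (M' := A.liftObj M') (l.map f) (A.naturality f)
  map_id M := Mod.hom_ext _ _ (l.map_id M)
  map_comp f g := Mod.hom_ext _ _ (l.map_comp f g)

theorem lift_full : A.lift.Full where
  map_surjective g := by
    obtain ⟨f, hf⟩ := A.exists_map g.hom (act_hom g)
    exact ⟨f, Mod.hom_ext _ _ hf⟩

theorem lift_faithful [l.Faithful] : A.lift.Faithful where
  map_injective h := l.map_injective (congrArg Mod.Hom.hom h)

theorem lift_essSurj : A.lift.EssSurj where
  mem_essImage X := by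
    obtain ⟨M, e, he⟩ := A.exists_obj X
    exact ⟨M, ⟨isoMk (M := A.liftObj M) e he⟩⟩

theorem lift_isEquivalence [l.Faithful] : A.lift.IsEquivalence where
  full := A.lift_full
  faithful := A.lift_faithful
  essSurj := A.lift_essSurj

variable [BraidedCategory C] [ComonObj N] [IsBialgebra N]

open scoped ComonObj in
/-- If `N` acts diagonally on tensor products, then the lift of `l` is a tensor functor. -/
@[reducible]
def liftCoreMonoidal
    (hδ : ∀ M M' : B, Intertwines (A.act (M ⊗ M')) (diagAct Δ[N] (A.act M) (A.act M'))
      (Functor.OplaxMonoidal.δ l M M'))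
    (hη : Intertwines (A.act (𝟙_ B)) ((ρ_ N).hom ≫ ε[N]) (Functor.OplaxMonoidal.η l)) :
    A.lift.CoreMonoidal where
  εIso := isoMk (M := unitMod N) (M' := A.liftObj (𝟙_ B)) (Functor.Monoidal.εIso l)
    (hη.inv (Functor.Monoidal.εIso l).symm)
  μIso M M' := isoMk (M := tensorMod (A.liftObj M) (A.liftObj M')) (M' := A.liftObj (M ⊗ M'))
    (Functor.Monoidal.μIso l M M') ((hδ M M').inv (Functor.Monoidal.μIso l M M').symm)
  μIso_hom_natural_left f X := Mod.hom_ext _ _ (Functor.LaxMonoidal.μ_natural_left l f X)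
  μIso_hom_natural_right X f := Mod.hom_ext _ _ (Functor.LaxMonoidal.μ_natural_right l X f)
  associativity X Y Z := Mod.hom_ext _ _ (Functor.LaxMonoidal.associativity l X Y Z)
  left_unitality X := Mod.hom_ext _ _ (Functor.LaxMonoidal.left_unitality l X)
  right_unitality X := Mod.hom_ext _ _ (Functor.LaxMonoidal.right_unitality l X)

end LiftedAction

/-! ### From an invertible fusion map to a convolution inverse. -/

section Fusion

open scoped MonObj

variable {C : Type u₁} [Category.{v₁} C] [MonoidalCategory C] {N : C} [MonObj N]

/-- If the fusion map `g ⊗ h ↦ g₁ ⊗ g₂ h` of an object that is both an algebra and a coalgebra is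
invertible, then the identity is convolution invertible. -/
theorem exists_convInverse_of_fusion (d : N ⟶ N ⊗ N) (e : N ⟶ 𝟙_ C)
    (hl : d ≫ e ▷ N = (λ_ N).inv) (hr : d ≫ N ◁ e = (ρ_ N).inv)
    (ha : d ≫ d ▷ N ≫ (α_ N N N).hom = d ≫ N ◁ d)
    [hF : IsIso (d ▷ N ≫ (α_ N N N).hom ≫ N ◁ μ[N])] :
    ∃ S : N ⟶ N, d ≫ S ▷ N ≫ μ[N] = e ≫ η[N] ∧ d ≫ N ◁ S ≫ μ[N] = e ≫ η[N] := by
  let Φ := d ▷ N ≫ (α_ N N N).hom ≫ N ◁ μ[N]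
  have : IsIso Φ := hF
  -- For a Hopf algebra, Φ⁻¹(g ⊗ 1) = g₁ ⊗ S(g₂), so `k` followed by the counit on the left recovers
  -- S. No compatibility of `d` with `μ[N]` is needed.
  let K := CategoryTheory.inv Φ
  let k : N ⟶ N ⊗ N := (ρ_ N).inv ≫ N ◁ η[N] ≫ K
  let S : N ⟶ N := k ≫ e ▷ N ≫ (λ_ N).hom
  have hΦη : (ρ_ N).inv ≫ N ◁ η[N] ≫ Φ = d := by
    simp only [Φ]
    rw [whisker_exchange_assoc, ← rightUnitor_inv_naturality_assoc,
      associator_naturality_right_assoc, ← whiskerLeft_comp, MonObj.mul_one]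
    simp
  -- Φ is right linear and, next, left colinear. Its inverse inherits both, which yields K(g ⊗ h) =
  -- k(g)h and k(g) = g₁ ⊗ S(g₂).
  have hΦlin : Φ ▷ N ≫ (α_ N N N).hom ≫ N ◁ μ[N] = (α_ N N N).hom ≫ N ◁ μ[N] ≫ Φ := by
    simp only [Φ, comp_whiskerRight, Category.assoc, whisker_assoc, Iso.inv_hom_id_assoc]
    rw [← whiskerLeft_comp, MonObj.mul_assoc, whisker_exchange_assoc]
    simp
  have hΦcolin : Φ ≫ d ▷ N ≫ (α_ N N N).hom = d ▷ N ≫ (α_ N N N).hom ≫ N ◁ Φ := by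
    simp only [Φ, Category.assoc, MonoidalCategory.whiskerLeft_comp]
    rw [whisker_exchange_assoc]
    have h := congrArg (fun t => t ▷ N) ha
    simp only [comp_whiskerRight] at h
    rw [← associator_naturality_middle_assoc, ← reassoc_of% h]
    simp
  have hK : K = k ▷ N ≫ (α_ N N N).hom ≫ N ◁ μ[N] := by
    have h : K ▷ N ≫ (α_ N N N).hom ≫ N ◁ μ[N] = (α_ N N N).hom ≫ N ◁ μ[N] ≫ K := by
      rw [← cancel_epi (Φ ▷ N), ← cancel_mono Φ]
      simp [K, hΦlin, ← comp_whiskerRight_assoc]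
    simp only [k, comp_whiskerRight, Category.assoc, h]
    rw [whisker_assoc]
    simp only [Category.assoc, Iso.inv_hom_id_assoc]
    rw [← whiskerLeft_comp_assoc, MonObj.one_mul]
    simp
  have hk : k = d ≫ N ◁ S := by
    have h : K ≫ d ▷ N ≫ (α_ N N N).hom = d ▷ N ≫ (α_ N N N).hom ≫ N ◁ K := by
      rw [← cancel_epi Φ, reassoc_of% hΦcolin, ← MonoidalCategory.whiskerLeft_comp]
      simp [K]
    have h' : k ≫ d ▷ N ≫ (α_ N N N).hom = d ≫ N ◁ k := by
      simp only [k, Category.assoc, h, MonoidalCategory.whiskerLeft_comp]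
      rw [whisker_exchange_assoc, ← rightUnitor_inv_naturality_assoc,
        associator_naturality_right_assoc]
      simp
    calc k = (k ≫ d ▷ N ≫ (α_ N N N).hom) ≫ N ◁ (e ▷ N ≫ (λ_ N).hom) := by
          simp only [Category.assoc, MonoidalCategory.whiskerLeft_comp]
          rw [← associator_naturality_middle_assoc, ← comp_whiskerRight_assoc, hr]
          simp
      _ = d ≫ N ◁ S := by
          rw [h']
          simp only [S, Category.assoc, MonoidalCategory.whiskerLeft_comp]
  refine ⟨S, ?_, ?_⟩
  -- Since Φ(g ⊗ 1) = g₁ ⊗ g₂, applying ε ⊗ id to K(g₁ ⊗ g₂) = g ⊗ 1 gives S(g₁)g₂ = ε(g)1.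
  · have h : d ≫ K = (ρ_ N).inv ≫ N ◁ η[N] := by
      rw [← hΦη]
      simp [K]
    have h' : S ▷ N ≫ μ[N] = K ≫ e ▷ N ≫ (λ_ N).hom := by
      rw [hK]
      simp only [S, comp_whiskerRight, Category.assoc]
      rw [whisker_exchange_assoc, leftUnitor_naturality]
      simp
    rw [h', reassoc_of% h, whisker_exchange_assoc, ← rightUnitor_inv_naturality_assoc,
      leftUnitor_naturality]
    simp [unitors_equal]
  -- Here ε ⊗ id is applied to Φ(k(g)) = g ⊗ 1, using (ε ⊗ id)Φ = μ.
  · have h : k ≫ Φ = (ρ_ N).inv ≫ N ◁ η[N] := by simp [k, K]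
    have h' : Φ ≫ e ▷ N ≫ (λ_ N).hom = μ[N] := by
      simp only [Φ, Category.assoc]
      rw [whisker_exchange_assoc, leftUnitor_naturality]
      have := congrArg (fun t => t ▷ N) hl
      simp only [comp_whiskerRight] at this
      rw [← associator_naturality_left_assoc, reassoc_of% this]
      simp
    have h'' := congrArg (fun t => t ≫ e ▷ N ≫ (λ_ N).hom) h
    simp only [Category.assoc, h'] at h''
    rw [hk, Category.assoc] at h''
    rw [h'', whisker_exchange_assoc, ← rightUnitor_inv_naturality_assoc, leftUnitor_naturality]
    simp [unitors_equal]

end Fusion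

/-! ### Antipode and skew antipode. -/

section Antipode

open scoped MonObj ComonObj HopfObj

variable {C : Type u₁} [Category.{v₁} C] [MonoidalCategory C] [BraidedCategory C]

/-- Naturality pulls both comultiplications to the front, where coassociativity applies; the
remaining inverse braidings agree by a Yang–Baxter argument. -/
theorem coopposite_assoc {N : C} [ComonObj N] :
    (Δ[N] ≫ (β_ N N).inv) ≫ (Δ[N] ≫ (β_ N N).inv) ▷ N ≫ (α_ N N N).hom =
      (Δ[N] ≫ (β_ N N).inv) ≫ N ◁ (Δ[N] ≫ (β_ N N).inv) := by
  have hl : (β_ N N).inv ≫ Δ[N] ▷ N = N ◁ Δ[N] ≫ (β_ (N ⊗ N) N).inv :=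
    (BraidedCategory.braiding_inv_naturality_right N Δ[N]).symm
  have hr : (β_ N N).inv ≫ N ◁ Δ[N] = Δ[N] ▷ N ≫ (β_ N (N ⊗ N)).inv :=
    (BraidedCategory.braiding_inv_naturality_left Δ[N] N).symm
  have hb : (β_ (N ⊗ N) N).inv ≫ (β_ N N).inv ▷ N = N ◁ (β_ N N).inv ≫ (β_ (N ⊗ N) N).inv :=
    (BraidedCategory.braiding_inv_naturality_right N (β_ N N).inv).symm
  simp only [comp_whiskerRight, MonoidalCategory.whiskerLeft_comp, Category.assoc]
  rw [reassoc_of% hl, reassoc_of% hr, reassoc_of% hb, ComonObj.comul_assoc_assoc]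
  simp

/-- A skew antipode (an antipode for the opposite comultiplication) is inverse to the antipode. -/
theorem isIso_antipode {N : C} [HopfObj N] (T : N ⟶ N)
    (hT : (Δ[N] ≫ (β_ N N).inv) ≫ T ▷ N ≫ μ[N] = ε[N] ≫ η[N]) : IsIso 𝒮[N] := by
  -- The antipode reverses products, so composing `hT` with it makes `T ≫ 𝒮[N]` a right convolution
  -- inverse of `𝒮[N]`. Dually, `h₂` uses that it reverses coproducts.
  have h₁ : Δ[N] ≫ 𝒮[N] ▷ N ≫ N ◁ (T ≫ 𝒮[N]) ≫ μ[N] = ε[N] ≫ η[N] := by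
    have h := congrArg (fun t => t ≫ 𝒮[N]) hT
    simp only [Category.assoc, HopfObj.mul_antipode, HopfObj.one_antipode] at h
    rw [← tensorHom_id, tensorHom_comp_tensorHom_assoc,
      BraidedCategory.braiding_naturality_assoc, Iso.inv_hom_id_assoc, Category.id_comp,
      MonoidalCategory.tensorHom_def, Category.assoc] at h
    exact h
  have h₂ : Δ[N] ≫ (𝒮[N] ≫ T) ▷ N ≫ N ◁ 𝒮[N] ≫ μ[N] = ε[N] ≫ η[N] := by
    have h := congrArg (fun t => 𝒮[N] ≫ t) hT
    simp only [Category.assoc, HopfObj.antipode_counit_assoc] at h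
    rw [reassoc_of% HopfObj.antipode_comul N, BraidedCategory.braiding_inv_naturality_assoc,
      Iso.hom_inv_id_assoc, ← tensorHom_id,
      tensorHom_comp_tensorHom_assoc, Category.comp_id, MonoidalCategory.tensorHom_def,
      Category.assoc] at h
    exact h
  have hS : Δ[N] ≫ (𝟙 N) ▷ N ≫ N ◁ 𝒮[N] ≫ μ[N] = ε[N] ≫ η[N] := by simp
  have hS' : Δ[N] ≫ 𝒮[N] ▷ N ≫ N ◁ (𝟙 N) ≫ μ[N] = ε[N] ≫ η[N] := by simp
  refine ⟨T, ?_, ?_⟩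
  -- The identity is also a convolution inverse of `𝒮[N]`, and inverses are unique.
  · exact left_inv_eq_right_inv (M := Conv N N) (a := 𝒮[N]) h₂ hS'
  · exact (left_inv_eq_right_inv (M := Conv N N) (a := 𝒮[N]) hS h₁).symm

variable (N : C) [MonObj N] [ComonObj N] [IsBialgebra N]

/-- If both fusion maps of a bialgebra are invertible, then it is a Hopf algebra. -/
theorem isHopfAlgebra_of_fusion
    [IsIso (Δ[N] ▷ N ≫ (α_ N N N).hom ≫ N ◁ μ[N])]
    [IsIso (Δ[N] ▷ N ≫ (α_ N N N).hom ≫ N ◁ (β_ N N).hom ≫ (α_ N N N).inv ≫ μ[N] ▷ N)] :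
    IsHopfAlgebra N := by
  obtain ⟨S, hS, hS'⟩ := exists_convInverse_of_fusion Δ[N] ε[N] (by simp) (by simp) (by simp)
  -- Up to c⁻¹, the second fusion map is the first one for the co-opposite comultiplication, so its
  -- convolution inverse is a skew antipode.
  have hF : (Δ[N] ≫ (β_ N N).inv) ▷ N ≫ (α_ N N N).hom ≫ N ◁ μ[N] =
      (Δ[N] ▷ N ≫ (α_ N N N).hom ≫ N ◁ (β_ N N).hom ≫ (α_ N N N).inv ≫ μ[N] ▷ N) ≫
        (β_ N N).inv := by
    simp only [Category.assoc]
    rw [BraidedCategory.braiding_inv_naturality_left]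
    simp
  have hF' : IsIso ((Δ[N] ≫ (β_ N N).inv) ▷ N ≫ (α_ N N N).hom ≫ N ◁ μ[N]) := by
    rw [hF]
    infer_instance
  obtain ⟨T, hT, -⟩ := exists_convInverse_of_fusion (Δ[N] ≫ (β_ N N).inv) ε[N]
    (by
      rw [Category.assoc, ← BraidedCategory.braiding_inv_naturality_right]
      simp [braiding_inv_tensorUnit_left])
    (by
      rw [Category.assoc, ← BraidedCategory.braiding_inv_naturality_left]
      simp [braiding_inv_tensorUnit_right])
    coopposite_assoc
  let _ : HopfObj N :=
    { mul_comul := IsBialgebra.mul_comul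
      one_comul := by
        rw [IsBialgebra.one_comul, MonObj.tensorObj.one_def]
      mul_counit := by
        rw [IsBialgebra.mul_counit, Comon.tensorObj_counit]
      one_counit := IsBialgebra.one_counit
      antipode := S
      antipode_left := hS
      antipode_right := hS' }
  exact ⟨S, isIso_antipode T hT, hS, hS'⟩

end Antipode

/-! ### Free modules. -/

section Linear

open scoped MonObj

variable {C : Type u₁} [Category.{v₁} C] [MonoidalCategory C] {N : C} [MonObj N]

/-- A linear morphism out of the free module `N ⊗ V` is determined by its restriction to `V`. -/
theorem eq_of_free_intertwines {V Z : C} {a : N ⊗ Z ⟶ Z} {f : N ⊗ V ⟶ Z}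
    (hf : Intertwines (rightAct μ[N] V) a f) : f = N ◁ ((λ_ V).inv ≫ η[N] ▷ V ≫ f) ≫ a := by
  rw [Intertwines, rightAct] at hf
  simp only [MonoidalCategory.whiskerLeft_comp, Category.assoc]
  rw [← hf]
  simp only [Category.assoc]
  rw [associator_inv_naturality_middle_assoc, ← comp_whiskerRight_assoc, MonObj.mul_one]
  simp

/-- A linear morphism out of the regular module is determined by the image of the unit. -/
theorem eq_of_regular_intertwines {Z : C} {a : N ⊗ Z ⟶ Z} {f : N ⟶ Z}
    (hf : Intertwines μ[N] a f) : f = (ρ_ N).inv ≫ N ◁ (η[N] ≫ f) ≫ a := by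
  rw [Intertwines] at hf
  simp only [MonoidalCategory.whiskerLeft_comp, Category.assoc]
  rw [← hf]
  simp

/-- The morphism `N ⊗ V ⟶ Z` extending a morphism from `V` to the module `Z` is linear. -/
theorem free_intertwines {V : C} (Z : Mod C N) (g : V ⟶ Z.X) :
    Intertwines (rightAct μ[N] V) (act Z) (N ◁ g ≫ act Z) := by
  rw [Intertwines, rightAct, Category.assoc, ← whisker_exchange_assoc, act_mul]
  simp

theorem unit_free {V : C} (Z : Mod C N) (g : V ⟶ Z.X) :
    η[N] ▷ V ≫ N ◁ g ≫ act Z = (λ_ V).hom ≫ g := by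
  rw [← whisker_exchange_assoc, act_one, leftUnitor_naturality]

/-- The regular module. -/
abbrev regularMod (N : C) [MonObj N] : Mod C N := modMk N μ[N] (by simp) (by simp)

theorem act_regularMod : act (regularMod N) = μ[N] := rfl

/-- The linear morphism from the regular module with a prescribed image of the unit. -/
theorem exists_regular_hom (Z : Mod C N) (z : 𝟙_ C ⟶ Z.X) :
    ∃ f : N ⟶ Z.X, Intertwines μ[N] (act Z) f ∧ η[N] ≫ f = z := by
  refine ⟨(ρ_ N).inv ≫ N ◁ z ≫ act Z, ?_, ?_⟩
  · rw [Intertwines, rightUnitor_inv_naturality_assoc, ← whisker_exchange_assoc, act_mul]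
    simp
  · rw [rightUnitor_inv_naturality_assoc, ← whisker_exchange_assoc, act_one,
      leftUnitor_naturality, ← unitors_inv_equal, Iso.inv_hom_id_assoc]

end Linear

/-! ### Rigidity makes the fusion maps invertible. -/

section Dual

open scoped MonObj ComonObj

variable {C : Type u₁} [Category.{v₁} C] [MonoidalCategory C] [BraidedCategory C]
  {N : C} [MonObj N] [ComonObj N] [IsBialgebra N]

/-- An exact pairing of modules is an exact pairing of the underlying objects. -/
@[reducible]
def underlyingPairing (X Y : Mod C N) [ExactPairing X Y] : ExactPairing X.X Y.X where
  coevaluation' := (η_ X Y).hom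
  evaluation' := (ε_ X Y).hom
  coevaluation_evaluation' :=
    congrArg Mod.Hom.hom (ExactPairing.coevaluation_evaluation X Y)
  evaluation_coevaluation' :=
    congrArg Mod.Hom.hom (ExactPairing.evaluation_coevaluation X Y)

/-- The tensor structure on modules is that of `C` on underlying objects, so transposition in `C`
underlies transposition of modules and preserves linearity. -/
theorem tensorRightHomEquiv_intertwines (W X Y Z : Mod C N) [ExactPairing X Y]
    {f : W.X ⊗ X.X ⟶ Z.X} (hf : Intertwines (tensorAct W X) (act Z) f) :
    letI := underlyingPairing X Y
    Intertwines (act W) (tensorAct Z Y) (tensorRightHomEquiv W.X X.X Y.X Z.X f) :=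
  act_hom (tensorRightHomEquiv W X Y Z (homMk (M := tensorMod W X) f hf))

theorem tensorRightHomEquiv_symm_intertwines (W X Y Z : Mod C N) [ExactPairing X Y]
    {f : W.X ⟶ Z.X ⊗ Y.X} (hf : Intertwines (act W) (tensorAct Z Y) f) :
    letI := underlyingPairing X Y
    Intertwines (tensorAct W X) (act Z) ((tensorRightHomEquiv W.X X.X Y.X Z.X).symm f) :=
  act_hom ((tensorRightHomEquiv W X Y Z).symm (homMk (M' := tensorMod Z Y) f hf))

theorem tensorLeftHomEquiv_intertwines (W X Y Z : Mod C N) [ExactPairing Y X]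
    {f : X.X ⊗ W.X ⟶ Z.X} (hf : Intertwines (tensorAct X W) (act Z) f) :
    letI := underlyingPairing Y X
    Intertwines (act W) (tensorAct Y Z) (tensorLeftHomEquiv W.X Y.X X.X Z.X f) :=
  act_hom (tensorLeftHomEquiv W Y X Z (homMk (M := tensorMod X W) f hf))

theorem tensorLeftHomEquiv_symm_intertwines (W X Y Z : Mod C N) [ExactPairing Y X]
    {f : W.X ⟶ Y.X ⊗ Z.X} (hf : Intertwines (act W) (tensorAct Y Z) f) :
    letI := underlyingPairing Y X
    Intertwines (tensorAct X W) (act Z) ((tensorLeftHomEquiv W.X Y.X X.X Z.X).symm f) :=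
  act_hom ((tensorLeftHomEquiv W Y X Z).symm (homMk (M' := tensorMod Y Z) f hf))

/-- Transposing gives linear maps from the regular module to Z ⊗ Y, determined by the image of the
unit. With the existence lemma below, N ⊗ X is free on X. -/
theorem tensorRight_ext (X Y Z : Mod C N) [ExactPairing X Y] {f g : N ⊗ X.X ⟶ Z.X}
    (hf : Intertwines (tensorAct (regularMod N) X) (act Z) f)
    (hg : Intertwines (tensorAct (regularMod N) X) (act Z) g)
    (h : η[N] ▷ X.X ≫ f = η[N] ▷ X.X ≫ g) : f = g := by
  let _ := underlyingPairing X Y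
  apply (tensorRightHomEquiv N X.X Y.X Z.X).injective
  have key (f : N ⊗ X.X ⟶ Z.X) : η[N] ≫ tensorRightHomEquiv N X.X Y.X Z.X f =
      tensorRightHomEquiv (𝟙_ C) X.X Y.X Z.X (η[N] ▷ X.X ≫ f) := by
    rw [← Equiv.symm_apply_eq, tensorRightHomEquiv_symm_naturality, Equiv.symm_apply_apply]
  rw [eq_of_regular_intertwines (tensorRightHomEquiv_intertwines _ X Y Z hf),
    eq_of_regular_intertwines (tensorRightHomEquiv_intertwines _ X Y Z hg), key, key, h]

theorem exists_tensorRight_hom (X Y Z : Mod C N) [ExactPairing X Y] (g : X.X ⟶ Z.X) :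
    ∃ f : N ⊗ X.X ⟶ Z.X, Intertwines (tensorAct (regularMod N) X) (act Z) f ∧
      η[N] ▷ X.X ≫ f = (λ_ X.X).hom ≫ g := by
  let _ := underlyingPairing X Y
  obtain ⟨f, hf, hf'⟩ := exists_regular_hom (tensorMod Z Y)
    (tensorRightHomEquiv (𝟙_ C) X.X Y.X Z.X ((λ_ X.X).hom ≫ g))
  refine ⟨_, tensorRightHomEquiv_symm_intertwines (regularMod N) X Y Z hf, ?_⟩
  rw [← tensorRightHomEquiv_symm_naturality, hf', Equiv.symm_apply_apply]

theorem tensorLeft_ext (X Y Z : Mod C N) [ExactPairing Y X] {f g : X.X ⊗ N ⟶ Z.X}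
    (hf : Intertwines (tensorAct X (regularMod N)) (act Z) f)
    (hg : Intertwines (tensorAct X (regularMod N)) (act Z) g)
    (h : X.X ◁ η[N] ≫ f = X.X ◁ η[N] ≫ g) : f = g := by
  let _ := underlyingPairing Y X
  apply (tensorLeftHomEquiv N Y.X X.X Z.X).injective
  have key (f : X.X ⊗ N ⟶ Z.X) : η[N] ≫ tensorLeftHomEquiv N Y.X X.X Z.X f =
      tensorLeftHomEquiv (𝟙_ C) Y.X X.X Z.X (X.X ◁ η[N] ≫ f) := by
    rw [← Equiv.symm_apply_eq, tensorLeftHomEquiv_symm_naturality, Equiv.symm_apply_apply]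
  rw [eq_of_regular_intertwines (tensorLeftHomEquiv_intertwines _ X Y Z hf),
    eq_of_regular_intertwines (tensorLeftHomEquiv_intertwines _ X Y Z hg), key, key, h]

theorem exists_tensorLeft_hom (X Y Z : Mod C N) [ExactPairing Y X] (g : X.X ⟶ Z.X) :
    ∃ f : X.X ⊗ N ⟶ Z.X, Intertwines (tensorAct X (regularMod N)) (act Z) f ∧
      X.X ◁ η[N] ≫ f = (ρ_ X.X).hom ≫ g := by
  let _ := underlyingPairing Y X
  obtain ⟨f, hf, hf'⟩ := exists_regular_hom (tensorMod Y Z)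
    (tensorLeftHomEquiv (𝟙_ C) Y.X X.X Z.X ((ρ_ X.X).hom ≫ g))
  refine ⟨_, tensorLeftHomEquiv_symm_intertwines (regularMod N) X Y Z hf, ?_⟩
  rw [← tensorLeftHomEquiv_symm_naturality, hf', Equiv.symm_apply_apply]

/-- N.X and N ⊗ X are both free on X, with generators 1 ⊗ x. The fusion map is the linear map
matching these generators, and `K` is its counterpart in the other direction. -/
theorem isIso_rightFusion (X Y : Mod C N) [ExactPairing X Y] :
    IsIso (Δ[N] ▷ X.X ≫ (α_ N N X.X).hom ≫ N ◁ act X) := by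
  let T := tensorMod (regularMod N) X
  let G := actObj (regularMod N) X.X
  have hH : Δ[N] ▷ X.X ≫ (α_ N N X.X).hom ≫ N ◁ act X =
      N ◁ ((λ_ X.X).inv ≫ η[N] ▷ X.X) ≫ act T := by
    have h : (N ⊗ N) ◁ ((λ_ X.X).inv ≫ η[N] ▷ X.X) ≫ tensorμ N N N X.X ≫ (μ[N] ⊗ₘ act X) =
        (α_ N N X.X).hom ≫ N ◁ act X := by
      rw [MonoidalCategory.whiskerLeft_comp_assoc, ← tensorHom_id, tensorμ_natural_right_assoc,
        tensorHom_comp_tensorHom, MonObj.mul_one, MonoidalCategory.tensorHom_def]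
      simp only [tensorμ, braiding_tensorUnit_right]
      monoidal
    rw [act_tensorMod, tensorAct, act_regularMod, whisker_exchange_assoc, h]
  rw [hH]
  have h₁ : Intertwines (rightAct μ[N] X.X) (act T) _ :=
    free_intertwines T ((λ_ X.X).inv ≫ η[N] ▷ X.X)
  have h₁' := unit_free T ((λ_ X.X).inv ≫ η[N] ▷ X.X)
  obtain ⟨K, hK, hK'⟩ := exists_tensorRight_hom X Y G ((λ_ X.X).inv ≫ η[N] ▷ X.X)
  rw [Iso.hom_inv_id_assoc] at h₁' hK'
  generalize N ◁ ((λ_ X.X).inv ≫ η[N] ▷ X.X) ≫ act T = H at h₁ h₁' ⊢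
  refine ⟨K, ?_, ?_⟩
  · rw [eq_of_free_intertwines (h₁.comp hK),
      eq_of_free_intertwines (Intertwines.id (rightAct μ[N] X.X)), reassoc_of% h₁', hK',
      Category.comp_id]
    rfl
  · refine tensorRight_ext X Y T (hK.comp h₁) (Intertwines.id _) ?_
    rw [reassoc_of% hK', h₁', Category.comp_id]

/-- Here X ⊗ N is free on X, by the dual on the other side; the braiding comes from moving the
second copy of `N` past X. -/
theorem isIso_leftFusion (X Y : Mod C N) [ExactPairing Y X] :
    IsIso (Δ[N] ▷ X.X ≫ (α_ N N X.X).hom ≫ N ◁ (β_ N X.X).hom ≫ (α_ N X.X N).inv ≫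
      act X ▷ N) := by
  let T := tensorMod X (regularMod N)
  let G := actObj (regularMod N) X.X
  have hH : Δ[N] ▷ X.X ≫ (α_ N N X.X).hom ≫ N ◁ (β_ N X.X).hom ≫ (α_ N X.X N).inv ≫
      act X ▷ N = N ◁ ((ρ_ X.X).inv ≫ X.X ◁ η[N]) ≫ act T := by
    have h : (N ⊗ N) ◁ ((ρ_ X.X).inv ≫ X.X ◁ η[N]) ≫ tensorμ N N X.X N ≫ (act X ⊗ₘ μ[N]) =
        (α_ N N X.X).hom ≫ N ◁ (β_ N X.X).hom ≫ (α_ N X.X N).inv ≫ act X ▷ N := by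
      rw [MonoidalCategory.whiskerLeft_comp_assoc, ← id_tensorHom X.X η[N],
        tensorμ_natural_right_assoc, tensorHom_comp_tensorHom, MonObj.mul_one, MonoidalCategory.tensorHom_def']
      simp only [tensorμ]
      monoidal
    rw [act_tensorMod, tensorAct, act_regularMod, whisker_exchange_assoc, h]
  rw [hH]
  have h₁ : Intertwines (rightAct μ[N] X.X) (act T) _ :=
    free_intertwines T ((ρ_ X.X).inv ≫ X.X ◁ η[N])
  have h₁' := unit_free T ((ρ_ X.X).inv ≫ X.X ◁ η[N])
  obtain ⟨K, hK, hK'⟩ := exists_tensorLeft_hom X Y G ((λ_ X.X).inv ≫ η[N] ▷ X.X)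
  generalize N ◁ ((ρ_ X.X).inv ≫ X.X ◁ η[N]) ≫ act T = H at h₁ h₁' ⊢
  refine ⟨K, ?_, ?_⟩
  · rw [eq_of_free_intertwines (h₁.comp hK),
      eq_of_free_intertwines (Intertwines.id (rightAct μ[N] X.X)), reassoc_of% h₁', hK']
    simp
    rfl
  · refine tensorLeft_ext X Y T (hK.comp h₁) (Intertwines.id _) ?_
    rw [reassoc_of% hK', h₁', Category.comp_id]
    simp

/-- A bialgebra whose category of modules is rigid is a Hopf algebra. -/
theorem isHopfAlgebra_of_rigid (N : C) [MonObj N] [ComonObj N] [IsBialgebra N]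
    [RigidCategory (Mod C N)] : IsHopfAlgebra N := by
  have h₁ : IsIso (Δ[N] ▷ N ≫ (α_ N N N).hom ≫ N ◁ μ[N]) :=
    isIso_rightFusion (regularMod N) (regularMod N)ᘁ
  have h₂ : IsIso (Δ[N] ▷ N ≫ (α_ N N N).hom ≫ N ◁ (β_ N N).hom ≫ (α_ N N N).inv ≫
      μ[N] ▷ N) :=
    isIso_leftFusion (regularMod N) (ᘁ(regularMod N))
  exact isHopfAlgebra_of_fusion N

end Dual

/-! ### Assembling the theorem. -/

section Splitting

variable {C : Type u₁} [Category.{v₁} C] [MonoidalCategory C] [BraidedCategory C]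
  {B : Type u₂} [Category.{v₂} B] [MonoidalCategory B]

theorem hasSplitBraiding (J : C ⥤ Center B) (l : B ⥤ C) [l.Monoidal]
    (ξ : inclusion J ⋙ l ≅ 𝟭 C) (hl : MapsHalfBraidingToInverse J l ξ) :
    LiftedAction.HasSplitBraiding ξ :=
  fun V M => ⟨((J.obj V).2.β M).hom, hl V M⟩

/-- The equivalence `F` is inverse to the lift of `l`. -/
noncomputable def isoInvLift {ι : C ⥤ B} [ι.Monoidal] {l : B ⥤ C} [l.Monoidal]
    (ξ : ι ⋙ l ≅ 𝟭 C) {N : C} [MonObj N] (F : Mod C N ⥤ B) [F.IsEquivalence]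
    (e : F ⋙ l ≅ Mod.forget N) (FT : ModuleFunctorStructure F ι) (hFT : IsTrivialUnder FT l ξ e)
    [(liftedAction ξ F e FT hFT).lift.IsEquivalence] :
    (liftedAction ξ F e FT hFT).lift.inv ≅ F :=
  let L := (liftedAction ξ F e FT hFT).lift
  -- `forgetIso` is linear, so the isomorphism of `F ⋙ l` with the forgetful functor lifts to
  -- modules.
  let i : F ⋙ L ≅ 𝟭 (Mod C N) := NatIso.ofComponents
    (fun X => isoMk (M := L.obj (F.obj X)) (M' := X) (forgetIso F e X)
      (transportedAct_obj F e X))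
    (fun f => Mod.hom_ext _ _ (forgetIso_naturality F f))
  (Functor.leftUnitor L.inv).symm ≪≫ Functor.isoWhiskerRight i.symm L.inv ≪≫
    Functor.associator F L L.inv ≪≫ Functor.isoWhiskerLeft F L.asEquivalence.unitIso.symm ≪≫
    Functor.rightUnitor F

end Splitting

end SplittingHopf

theorem mainTheorem8
    {C : Type u₁} [Category.{v₁} C] [MonoidalCategory C] [BraidedCategory C]
    {B : Type u₂} [Category.{v₂} B] [MonoidalCategory B]
    -- the tensor functor `ι = inclusion J`, with its extension `J` to a braided functor
    (J : C ⥤ Center B) [J.Monoidal] (hJ : SplittingHopf.IsBraidedOnReverse J)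
    -- the splitting tensor functor
    (l : B ⥤ C) [l.Monoidal]
    (ξ : SplittingHopf.inclusion J ⋙ l ≅ 𝟭 C) [NatTrans.IsMonoidal ξ.hom]
    (hl : SplittingHopf.MapsHalfBraidingToInverse J l ξ)
    -- the algebra and the equivalence, compatible with the functors to `C`
    (N : C) [MonObj N] (F : Mod C N ⥤ B) [F.IsEquivalence] (η : F ⋙ l ≅ Mod.forget N)
    -- the structure of an equivalence of right module categories
    (FT : SplittingHopf.ModuleFunctorStructure F (SplittingHopf.inclusion J))
    (hFT : SplittingHopf.IsTrivialUnder FT l ξ η) :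
    ∃ (_ : ComonObj N) (_ : SplittingHopf.IsBialgebra N),
      Nonempty F.Monoidal ∧
      ∀ (_ : RigidCategory C) (_ : RigidCategory B),
        SplittingHopf.IsHopfAlgebra N ∧ Nonempty (RigidCategory (Mod C N)) := by
  let A := SplittingHopf.liftedAction ξ F η FT hFT
  have hξ := SplittingHopf.hasSplitBraiding J l ξ hl
  have := SplittingHopf.faithful_of_forget η
  have := A.lift_isEquivalence
  let _ := A.comonObj hξ
  have hN : SplittingHopf.IsBialgebra N := A.isBialgebra hξ
  let _ : A.lift.Monoidal :=
    (A.liftCoreMonoidal (A.δ_intertwines_diagAct hξ) A.η_intertwines).toMonoidal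
  let _ : A.lift.asEquivalence.functor.Monoidal := ‹A.lift.Monoidal›
  let _ : A.lift.inv.Monoidal := A.lift.asEquivalence.inverseMonoidal
  -- The inverse of a monoidal equivalence is monoidal, and `F` is isomorphic to the inverse of the
  -- lift.
  let hF : F.Monoidal := Functor.Monoidal.transport (SplittingHopf.isoInvLift ξ F η FT hFT)
  refine ⟨_, hN, ⟨hF⟩, fun _ _ => ?_⟩
  let _ : F.asEquivalence.functor.Monoidal := hF
  let hM : RigidCategory (Mod C N) := rigidCategoryOfEquivalence F.asEquivalence.toAdjunction
  exact ⟨SplittingHopf.isHopfAlgebra_of_rigid N, ⟨hM⟩⟩
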